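/- **Conventions.** A meet-semilattice is a poset with all finite meets (so it has a top $1$, but possibly no bottom). It is distributive if $a\wedge b\le c$ implies $c=a'\wedge b'$ for some $a'\ge a$, $b'\ge b$. $\mathsf{DMS}$ is the category of distributive meet-semilattices and maps preserving finite meets (including $1$). $\mathsf{AlgFrm_J}$ is the category of algebraic frames (frames in which every element is a join of compact elements) and maps preserving arbitrary joins and compact elements. Let $X$ be a Priestley space and $X_0\subseteq X$. A clopen upset $U$ of $X$ is admissible if every maximal point of $X\setminus U$ lies in $X_0$; $\mathcal A(X)$ is the set of these, and $\mathcal I_x=\{U\in\mathcal A(X): x\notin U\}$. A pointed generalized Priestley space is a tuple $\langle X,\tau,\le,X_0,m\rangle$ such that $\langle X,\tau,\le\rangle$ is a (compact) Priestley space, $m$ is its maximum, $X_0$ is a dense subset of $X\setminus\{m\}$, every $x\ne m$ lies below some point of $X_0$, $x\in X_0$ iff $\mathcal I_x$ is nonempty and directed, and $x\le y$ iff every $U\in\mathcal A(X)$ that contains $x$ contains $y$. For $R\subseteq X\times Y$ let $\Box_RU=\{x: R[x]\subseteq U\}$. A morphism from $X$ to $Y$ in $\mathsf{PGPS}$ is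 a relation $R\subseteq X\times Y$ such that (1) if not $x\,R\,y$, then there is $U\in\mathcal A(Y)$ with $R[x]\subseteq U$ and $y\notin U$, and (2) $\Box_RU\in\mathcal A(X)$ for all $U\in\mathcal A(Y)$. Identities are the orders, and $x\,(S*R)\,z$ iff every $U\in\mathcal A(Z)$ with $x\in\Box_R\Box_SU$ contains $z$. **Functors.** * $\mathcal F:\mathsf{DMS}\to\mathsf{AlgFrm_J}$ sends $M$ to its lattice of filters under inclusion and $\alpha$ to $F\mapsto{\uparrow}\alpha[F]$. * $\mathcal K:\mathsf{AlgFrm_J}\to\mathsf{DMS}$ sends $L$ to its set of compact elements under the order dual to that of $L$ and a morphism to its restriction. * $\mathcal V^a:\mathsf{PGPS}\to\mathsf{AlgFrm_J}$ (contravariant) sends $X$ to the set of closed upsets $C$ with $X\setminus C={\downarrow}(X_0\setminus C)$ under reverse inclusion, and $R$ to $\Box_R$. * $\mathcal Y:\mathsf{AlgFrm_J}\to\mathsf{PGPS}$ (contravariant) sends $L$ to $\langle Y_L,\tau,\le,P(L),1\rangle$. Here $P(L)$ is the set of (meet-)prime elements; $Y_L$ consists of $1$ and of the pseudoprime elements of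 $L$, i.e. those $p\neq1$ such that $a_1\wedge\dots\wedge a_n\ll p$ implies $a_i\le p$ for some $i$; and $\tau$ is the restriction to $Y_L$ of the topology on $L$ with subbasis the sets ${\uparrow}k$ and their complements, $k$ compact. It sends $\alpha:L\to N$ with right adjoint $r$ to the relation $\{(p,q)\in Y_N\times Y_L: r(p)\le q\}$. * $\mathcal A:\mathsf{PGPS}\to\mathsf{DMS}$ (contravariant) sends $X$ to $\mathcal A(X)$ under inclusion and $R$ to $\Box_R$. * $\mathcal X:\mathsf{DMS}\to\mathsf{PGPS}$ (contravariant) sends $M$ to $\langle X_M,\tau,\subseteq,\mathrm{Pr}(M),M\rangle$. Here $X_M$ consists of the improper filter $M$ and of the optimal filters of $M$, i.e. the restrictions to $M$ of the prime filters of the distributive envelope $D(M)$, the universal distributive lattice with top under $M$ with respect to maps preserving finite meets and all existing finite joins; $\mathrm{Pr}(M)$ is the set of proper filters $P$ such that $F\cap G\subseteq P$ implies $F\subseteq P$ or $G\subseteq P$ for all filters $F,G$; and $\tau$ has as subbasis the sets $\{x\in X_M: a\in x\}$, $a\in M$, and their complements. It sends $\alpha:M\to N$ to the relation $\{(x,y)\in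 X_N\times X_M:\alpha^{-1}(x)\subseteq y\}$. **Theorem.** All six are well-defined functors. $\mathcal F$ and $\mathcal K$ establish an equivalence of $\mathsf{DMS}$ and $\mathsf{AlgFrm_J}$, $\mathcal Y$ and $\mathcal V^a$ establish a dual equivalence of $\mathsf{AlgFrm_J}$ and $\mathsf{PGPS}$, and $\mathcal X$ and $\mathcal A$ establish a dual equivalence of $\mathsf{DMS}$ and $\mathsf{PGPS}$. Moreover, the last pair consists of compositions of the other functors: $$\mathcal X=\mathcal Y\circ\mathcal F\qquad\text{and}\qquad\mathcal A=\mathcal K\circ\mathcal V^a .$$ (In the second equality, admissible clopen upsets are identified with the compact elements of $\mathcal V^a(X)$ via $U\mapsto U$, naturally in $X$.) -/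

import Mathlib

open CategoryTheory Order

universe u

namespace GenPriestley

/-! ### Distributive meet-semilattices (with top) -/

/-- Distributivity of a meet-semilattice. -/
def IsDistribMeet (M : Type u) [SemilatticeInf M] : Prop :=
  ∀ a b c : M, a ⊓ b ≤ c → ∃ a' b' : M, a ≤ a' ∧ b ≤ b' ∧ a' ⊓ b' = c

/-- Distributive meet-semilattices with top (a bottom is not required). -/
structure DMS : Type (u + 1) where
  carrier : Type u
  [semilatticeInf : SemilatticeInf carrier]
  [orderTop : OrderTop carrier]
  distrib : IsDistribMeet carrier

instance : CoeSort DMS.{u} (Type u) := ⟨DMS.carrier⟩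

attribute [instance] DMS.semilatticeInf DMS.orderTop

/-- Morphisms of `DMS` are the maps preserving all finite meets, the empty one included. -/
instance : Category.{u} DMS.{u} where
  Hom M N := InfTopHom M N
  id M := InfTopHom.id M
  comp f g := g.comp f

/-! ### Algebraic frames -/

/-- The join infinite distributive law. -/
def IsFrameLattice (L : Type u) [CompleteLattice L] : Prop :=
  ∀ (a : L) (S : Set L), a ⊓ sSup S = ⨆ s ∈ S, a ⊓ s

/-- Algebraic frames: frames in which every element is a join of compact elements. -/
structure AlgFrmJ : Type (u + 1) where
  carrier : Type u
  [completeLattice : CompleteLattice carrier]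
  [algebraic : IsCompactlyGenerated carrier]
  frame : IsFrameLattice carrier

instance : CoeSort AlgFrmJ.{u} (Type u) := ⟨AlgFrmJ.carrier⟩

attribute [instance] AlgFrmJ.completeLattice AlgFrmJ.algebraic

/-- Maps preserving arbitrary joins and compact elements. -/
@[ext]
structure AlgFrmJ.Hom (L N : AlgFrmJ.{u}) : Type u where
  toFun : L → N
  map_sSup : ∀ S : Set L, toFun (sSup S) = sSup (toFun '' S)
  map_compact : ∀ k : L, IsCompactElement k → IsCompactElement (toFun k)

instance : Category.{u} AlgFrmJ.{u} where
  Hom L N := AlgFrmJ.Hom L N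
  id L := ⟨id, fun S => by simp, fun _ h => h⟩
  comp f g := ⟨g.toFun ∘ f.toFun,
    fun S => by simp [f.map_sSup, g.map_sSup, Set.image_image],
    fun k h => g.map_compact _ (f.map_compact k h)⟩

/-! ### Pointed generalized Priestley spaces -/

section Spaces

variable {X Y Z : Type u} [TopologicalSpace X] [PartialOrder X] [TopologicalSpace Y]
  [PartialOrder Y] [TopologicalSpace Z] [PartialOrder Z]

/-- Admissible clopen upsets, relative to the distinguished subset `X₀`: all maximal points of
the complement lie in `X₀`. -/
structure IsAdmissible (X₀ : Set X) (U : Set X) : Prop where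
  isClopen : IsClopen U
  isUpperSet : IsUpperSet U
  maximal_mem : ∀ x, Maximal (· ∈ Uᶜ) x → x ∈ X₀

/-- `𝓘ₓ`: the admissible clopen upsets that miss `x`. -/
def missing (X₀ : Set X) (x : X) : Set (Set X) := {U | IsAdmissible X₀ U ∧ x ∉ U}

/-- Pointed generalized Priestley spaces. -/
structure IsPGPS (X₀ : Set X) (m : X) : Prop where
  compact : CompactSpace X
  priestley : PriestleySpace X
  isTop : IsTop m
  subset : X₀ ⊆ {m}ᶜ
  dense : {m}ᶜ ⊆ closure X₀
  order_dense : ∀ x ∈ ({m}ᶜ : Set X), ∃ y ∈ X₀, x ≤ y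
  mem_iff : ∀ x, x ∈ X₀ ↔ (missing X₀ x).Nonempty ∧ DirectedOn (· ⊆ ·) (missing X₀ x)
  le_iff : ∀ x y, x ≤ y ↔ ∀ U, IsAdmissible X₀ U → x ∈ U → y ∈ U

/-- `□_R U = {x | R[x] ⊆ U}`. -/
def box (R : X → Y → Prop) (U : Set Y) : Set X := {x | ∀ y, R x y → y ∈ U}

/-- Generalized Priestley morphisms. -/
structure IsGPMorphism (X₀ : Set X) (Y₀ : Set Y) (R : X → Y → Prop) : Prop where
  separated : ∀ x y, ¬ R x y → ∃ U, IsAdmissible Y₀ U ∧ (∀ z, R x z → z ∈ U) ∧ y ∉ U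
  box_admissible : ∀ U, IsAdmissible Y₀ U → IsAdmissible X₀ (box R U)

/-- The composition `S * R` of `R ⊆ X × Y` and `S ⊆ Y × Z`. -/
def starComp (Z₀ : Set Z) (R : X → Y → Prop) (S : Y → Z → Prop) : X → Z → Prop :=
  fun x z => ∀ U, IsAdmissible Z₀ U → x ∈ box R (box S U) → z ∈ U

theorem starComp_of {Z₀ : Set Z} {R : X → Y → Prop} {S : Y → Z → Prop} {x : X} {y : Y} {z : Z}
    (h : R x y) (h' : S y z) : starComp Z₀ R S x z := fun _ _ hx => hx y h z h'

theorem box_starComp {Z₀ : Set Z} (R : X → Y → Prop) (S : Y → Z → Prop) {U : Set Z}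
    (hU : IsAdmissible Z₀ U) : box (starComp Z₀ R S) U = box R (box S U) := by
  ext x
  exact ⟨fun hx y hy z hz => hx z (starComp_of hy hz), fun hx z hz => hz U hU hx⟩

theorem box_le {U : Set X} (hU : IsUpperSet U) : box (fun x y : X => x ≤ y) U = U := by
  ext x
  exact ⟨fun hx => hx x le_rfl, fun hx y hy => hU hy hx⟩

theorem IsPGPS.isGPMorphism_le {X₀ : Set X} {m : X} (h : IsPGPS X₀ m) :
    IsGPMorphism X₀ X₀ (fun x y : X => x ≤ y) where
  separated x y hxy := by
    rw [h.le_iff] at hxy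
    push Not at hxy
    obtain ⟨U, hU, hx, hy⟩ := hxy
    exact ⟨U, hU, fun z hz => hU.isUpperSet hz hx, hy⟩
  box_admissible U hU := by rwa [box_le hU.isUpperSet]

theorem IsGPMorphism.starComp {X₀ : Set X} {Y₀ : Set Y} {Z₀ : Set Z} {R : X → Y → Prop}
    {S : Y → Z → Prop} (hR : IsGPMorphism X₀ Y₀ R) (hS : IsGPMorphism Y₀ Z₀ S) :
    IsGPMorphism X₀ Z₀ (starComp Z₀ R S) where
  separated x z hxz := by
    unfold GenPriestley.starComp at hxz
    push Not at hxz
    obtain ⟨U, hU, hx, hz⟩ := hxz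
    exact ⟨U, hU, fun w hw => hw U hU hx, hz⟩
  box_admissible U hU := by
    rw [box_starComp R S hU]
    exact hR.box_admissible _ (hS.box_admissible _ hU)

theorem IsGPMorphism.iff_forall {X₀ : Set X} {Y₀ : Set Y} {R : X → Y → Prop}
    (hR : IsGPMorphism X₀ Y₀ R) (x : X) (y : Y) :
    R x y ↔ ∀ U, IsAdmissible Y₀ U → x ∈ box R U → y ∈ U := by
  refine ⟨fun h U _ hx => hx y h, fun h => ?_⟩
  by_contra hxy
  obtain ⟨U, hU, hx, hy⟩ := hR.separated x y hxy
  exact hy (h U hU hx)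

end Spaces

/-- Bundled pointed generalized Priestley spaces. -/
structure PGPS : Type (u + 1) where
  carrier : Type u
  [topology : TopologicalSpace carrier]
  [order : PartialOrder carrier]
  dom : Set carrier
  pt : carrier
  isPGPS : IsPGPS dom pt

instance : CoeSort PGPS.{u} (Type u) := ⟨PGPS.carrier⟩

attribute [instance] PGPS.topology PGPS.order

/-- Generalized Priestley morphisms between bundled spaces. -/
@[ext]
structure PGPS.Hom (X Y : PGPS.{u}) : Type u where
  rel : X → Y → Prop
  isGPMorphism : IsGPMorphism X.dom Y.dom rel

/-- The identity of `X` is its order, and composition is `*`. -/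
instance : Category.{u} PGPS.{u} where
  Hom X Y := PGPS.Hom X Y
  id X := ⟨fun x y => x ≤ y, X.isPGPS.isGPMorphism_le⟩
  comp {_ _ Z} R S := ⟨starComp Z.dom R.rel S.rel, R.isGPMorphism.starComp S.isGPMorphism⟩
  id_comp {X Y} R := by
    apply PGPS.Hom.ext
    funext x y
    apply propext
    rw [R.isGPMorphism.iff_forall]
    refine forall₂_congr fun U hU => ?_
    rw [box_le (R.isGPMorphism.box_admissible U hU).isUpperSet]
  comp_id {X Y} R := by
    apply PGPS.Hom.ext
    funext x y
    apply propext
    rw [R.isGPMorphism.iff_forall]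
    refine forall₂_congr fun U hU => ?_
    rw [box_le hU.isUpperSet]
  assoc {W X Y Z} R S T := by
    apply PGPS.Hom.ext
    funext x y
    apply propext
    refine forall₂_congr fun U hU => ?_
    rw [box_starComp _ _ (T.isGPMorphism.box_admissible U hU), box_starComp _ _ hU]

/-! ### The filter functor -/

section Filters

variable {M N : Type u} [SemilatticeInf M] [OrderTop M] [SemilatticeInf N] [OrderTop N]

/-- A filter from an upset that contains `⊤` and is closed under binary meets. -/
def mkFilter (S : Set M) (top : ⊤ ∈ S) (inf : ∀ a ∈ S, ∀ b ∈ S, a ⊓ b ∈ S)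
    (up : ∀ a b, a ≤ b → a ∈ S → b ∈ S) : PFilter M :=
  (IsPFilter.of_def (F := S) ⟨⊤, top⟩
    (fun a ha b hb => ⟨a ⊓ b, inf a ha b hb, inf_le_left, inf_le_right⟩)
    (fun {a b} h ha => up a b h ha)).toPFilter

theorem mem_mkFilter {S : Set M} {top inf up} {a : M} :
    a ∈ mkFilter S top inf up ↔ a ∈ S := Iff.rfl

theorem top_mem_filter (F : PFilter M) : ⊤ ∈ F := by
  obtain ⟨a, ha⟩ := F.nonempty
  exact PFilter.mem_of_le le_top ha

/-- The intersection of a family of filters. -/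
instance : InfSet (PFilter M) where
  sInf S := mkFilter {a | ∀ F ∈ S, a ∈ F} (fun F _ => top_mem_filter F)
    (fun _ ha _ hb F hF => PFilter.inf_mem (ha F hF) (hb F hF))
    (fun _ _ h ha F hF => PFilter.mem_of_le h (ha F hF))

/-- The lattice of filters, ordered by inclusion. -/
instance : CompleteLattice (PFilter M) :=
  completeLatticeOfInf (PFilter M) fun S =>
    ⟨fun F hF _ ha => ha F hF, fun _ hG _ ha F hF => hG hF ha⟩

theorem mem_sInf_filter {S : Set (PFilter M)} {a : M} : a ∈ sInf S ↔ ∀ F ∈ S, a ∈ F := Iff.rfl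

theorem mem_inf_filter {F G : PFilter M} {a : M} : a ∈ F ⊓ G ↔ a ∈ F ∧ a ∈ G := by
  constructor
  · intro h
    exact ⟨(inf_le_left : F ⊓ G ≤ F) h, (inf_le_right : F ⊓ G ≤ G) h⟩
  · rintro ⟨hF, hG⟩
    have : PFilter.principal a ≤ F ⊓ G :=
      le_inf (PFilter.principal_le_iff.2 hF) (PFilter.principal_le_iff.2 hG)
    exact PFilter.principal_le_iff.1 this

theorem mem_top_filter (a : M) : a ∈ (⊤ : PFilter M) :=
  PFilter.principal_le_iff.1 le_top

theorem mem_sSup_filter_of_directed {S : Set (PFilter M)} (hne : S.Nonempty)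
    (hS : DirectedOn (· ≤ ·) S) {a : M} : a ∈ sSup S ↔ ∃ F ∈ S, a ∈ F := by
  refine ⟨fun h => ?_, fun ⟨F, hF, ha⟩ => (le_sSup hF : F ≤ sSup S) ha⟩
  let G : PFilter M := mkFilter {a | ∃ F ∈ S, a ∈ F}
    (let ⟨F, hF⟩ := hne; ⟨F, hF, top_mem_filter F⟩)
    (by
      rintro a ⟨F, hF, ha⟩ b ⟨G, hG, hb⟩
      obtain ⟨H, hH, h1, h2⟩ := hS F hF G hG
      exact ⟨H, hH, PFilter.inf_mem (h1 ha) (h2 hb)⟩)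
    (fun a b h ⟨F, hF, ha⟩ => ⟨F, hF, PFilter.mem_of_le h ha⟩)
  have : sSup S ≤ G := sSup_le fun F hF b hb => ⟨F, hF, hb⟩
  exact this h

theorem isCompactElement_principal (a : M) : IsCompactElement (PFilter.principal a) := by
  rw [CompleteLattice.isCompactElement_iff_le_of_directed_sSup_le]
  intro S hne hS h
  rw [PFilter.principal_le_iff, mem_sSup_filter_of_directed hne hS] at h
  obtain ⟨F, hF, ha⟩ := h
  exact ⟨F, hF, PFilter.principal_le_iff.2 ha⟩

theorem sSup_principal (F : PFilter M) : sSup (PFilter.principal '' (F : Set M)) = F := by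
  refine le_antisymm (sSup_le ?_) fun a ha => ?_
  · rintro _ ⟨a, ha, rfl⟩
    exact PFilter.principal_le_iff.2 ha
  · exact PFilter.principal_le_iff.1 (le_sSup ⟨a, ha, rfl⟩)

theorem isCompactElement_filter_iff {F : PFilter M} :
    IsCompactElement F ↔ ∃ a, F = PFilter.principal a := by
  refine ⟨fun h => ?_, ?_⟩
  · rw [CompleteLattice.isCompactElement_iff_le_of_directed_sSup_le] at h
    have hdir : DirectedOn (· ≤ ·) (PFilter.principal '' (F : Set M)) := by
      rintro _ ⟨a, ha, rfl⟩ _ ⟨b, hb, rfl⟩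
      exact ⟨_, ⟨a ⊓ b, PFilter.inf_mem ha hb, rfl⟩, PFilter.antitone_principal inf_le_left,
        PFilter.antitone_principal inf_le_right⟩
    obtain ⟨G, ⟨a, ha, rfl⟩, hF⟩ := h (PFilter.principal '' (F : Set M))
      (F.nonempty.image _) hdir (sSup_principal F).ge
    exact ⟨a, le_antisymm hF (PFilter.principal_le_iff.2 ha)⟩
  · rintro ⟨a, rfl⟩
    exact isCompactElement_principal a

instance : IsCompactlyGenerated (PFilter M) where
  exists_sSup_eq F := ⟨PFilter.principal '' (F : Set M), by
    rintro _ ⟨a, -, rfl⟩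
    exact isCompactElement_principal a, sSup_principal F⟩

theorem isFrameLattice_filter (hM : IsDistribMeet M) : IsFrameLattice (PFilter M) := by
  intro F S
  refine le_antisymm ?_ (iSup₂_le fun G hG => inf_le_inf_left _ (le_sSup hG))
  set T : PFilter M := ⨆ G ∈ S, F ⊓ G with hT
  let H : PFilter M := mkFilter {x | ∀ a ∈ F, x ≤ a → a ∈ T}
    (fun a _ h => by rw [top_le_iff.1 h]; exact top_mem_filter T)
    (by
      intro x hx y hy a ha hxy
      obtain ⟨x', y', h1, h2, rfl⟩ := hM x y a hxy
      exact PFilter.inf_mem (hx x' (PFilter.mem_of_le inf_le_left ha) h1)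
        (hy y' (PFilter.mem_of_le inf_le_right ha) h2))
    (fun x y h hx a ha hy => hx a ha (h.trans hy))
  have hSH : sSup S ≤ H := sSup_le fun G hG x hx a ha hxa =>
    (le_iSup₂_of_le (f := fun G (_ : G ∈ S) => F ⊓ G) G hG le_rfl : F ⊓ G ≤ T)
      (mem_inf_filter.2 ⟨ha, PFilter.mem_of_le hxa hx⟩)
  intro a ha
  rw [mem_inf_filter] at ha
  exact hSH ha.2 a ha.1 le_rfl

/-- The preimage of a filter. -/
def filterComap (f : InfTopHom M N) (G : PFilter N) : PFilter M :=
  mkFilter {a | f a ∈ G} (by simp [top_mem_filter G])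
    (fun a ha b hb => by simpa using PFilter.inf_mem ha hb)
    (fun a b h ha => PFilter.mem_of_le (OrderHomClass.mono f h) ha)

/-- `↑f[F]`, the upset generated by the image of a filter. -/
def filterMap (f : InfTopHom M N) (F : PFilter M) : PFilter N :=
  mkFilter {b | ∃ a ∈ F, f a ≤ b} ⟨⊤, top_mem_filter F, le_top⟩
    (by
      rintro b ⟨a, ha, hab⟩ d ⟨c, hc, hcd⟩
      exact ⟨a ⊓ c, PFilter.inf_mem ha hc, by rw [map_inf]; exact inf_le_inf hab hcd⟩)
    (fun b c h ⟨a, ha, hab⟩ => ⟨a, ha, hab.trans h⟩)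

theorem filter_gc (f : InfTopHom M N) : GaloisConnection (filterMap f) (filterComap f) := by
  intro F G
  refine ⟨fun h a ha => h ⟨a, ha, le_rfl⟩, ?_⟩
  rintro h b ⟨a, ha, hab⟩
  exact PFilter.mem_of_le hab (h ha)

theorem filterMap_principal (f : InfTopHom M N) (a : M) :
    filterMap f (PFilter.principal a) = PFilter.principal (f a) := by
  refine le_antisymm ?_ (PFilter.principal_le_iff.2 ⟨a, PFilter.principal_le_iff.1 le_rfl, le_rfl⟩)
  rw [filter_gc f _ _, PFilter.principal_le_iff]
  show f a ∈ PFilter.principal (f a)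
  exact PFilter.principal_le_iff.1 le_rfl

end Filters

/-- The functor `𝓕`: it sends `M` to its lattice of filters and `α` to `F ↦ ↑α[F]`. -/
def filterFunctor : DMS.{u} ⥤ AlgFrmJ.{u} where
  obj M := { carrier := PFilter M, frame := isFrameLattice_filter M.distrib }
  map {M N} α :=
    { toFun := filterMap (M := M) (N := N) α
      map_sSup := fun S => by
        rw [sSup_image]
        exact (filter_gc (M := M) (N := N) α).l_sSup
      map_compact := fun F hF => by
        obtain ⟨a, rfl⟩ := isCompactElement_filter_iff.1 hF
        rw [filterMap_principal]
        exact isCompactElement_principal _ }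
  map_id M := by
    apply AlgFrmJ.Hom.ext
    funext F
    apply le_antisymm
    · rintro b ⟨a, ha, hab⟩
      exact PFilter.mem_of_le hab ha
    · exact fun a ha => ⟨a, ha, le_rfl⟩
  map_comp {M N P} α β := by
    apply AlgFrmJ.Hom.ext
    funext F
    apply le_antisymm
    · rintro b ⟨a, ha, hab⟩
      exact ⟨_, ⟨a, ha, le_rfl⟩, hab⟩
    · rintro b ⟨a, ⟨c, hc, hca⟩, hab⟩
      exact ⟨c, hc, le_trans (OrderHomClass.mono (show InfTopHom N P from β) hca) hab⟩

/-! ### The functor of compact elements -/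

section Compact

variable {L : Type u} [CompleteLattice L]

theorem isCompactElement_bot : IsCompactElement (⊥ : L) := by
  rw [CompleteLattice.isCompactElement_iff_le_of_directed_sSup_le]
  exact fun S ⟨a, ha⟩ _ _ => ⟨a, ha, bot_le⟩

theorem compact_sup {a b : L} (ha : IsCompactElement a) (hb : IsCompactElement b) :
    IsCompactElement (a ⊔ b) := by
  rw [CompleteLattice.isCompactElement_iff_le_of_directed_sSup_le] at *
  intro S hne hS h
  obtain ⟨x, hx, hax⟩ := ha S hne hS (le_sup_left.trans h)
  obtain ⟨y, hy, hby⟩ := hb S hne hS (le_sup_right.trans h)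
  obtain ⟨z, hz, hxz, hyz⟩ := hS x hx y hy
  exact ⟨z, hz, sup_le (hax.trans hxz) (hby.trans hyz)⟩

/-- The compact elements below a given one form a directed set. -/
theorem directedOn_compact_le (b : L) :
    DirectedOn (· ≤ ·) {k : L | IsCompactElement k ∧ k ≤ b} := fun x hx y hy =>
  ⟨x ⊔ y, ⟨compact_sup hx.1 hy.1, sup_le hx.2 hy.2⟩, le_sup_left, le_sup_right⟩

theorem exists_compact_not_le [IsCompactlyGenerated L] {a b : L} (h : ¬ a ≤ b) :
    ∃ k, IsCompactElement k ∧ k ≤ a ∧ ¬ k ≤ b := by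
  rw [le_iff_compact_le_imp] at h
  push Not at h
  exact h

theorem IsFrameLattice.inf_sup (hL : IsFrameLattice L) (a b c : L) :
    a ⊓ (b ⊔ c) = (a ⊓ b) ⊔ (a ⊓ c) := by
  have := hL a {b, c}
  rwa [sSup_pair, iSup_pair] at this

theorem IsFrameLattice.sup_inf_le (hL : IsFrameLattice L) (a b c : L) :
    (a ⊔ b) ⊓ (a ⊔ c) ≤ a ⊔ (b ⊓ c) := by
  rw [hL.inf_sup]
  refine sup_le (inf_le_right.trans le_sup_left) ?_
  rw [inf_comm, hL.inf_sup]
  exact sup_le (inf_le_right.trans le_sup_left) (by rw [inf_comm]; exact le_sup_right)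

/-- The compact elements of `L`. -/
@[ext]
structure CompactElt (L : Type u) [CompleteLattice L] : Type u where
  val : L
  isCompact : IsCompactElement val

/-- Compact elements carry the order *dual* to that of `L`, so that meets are joins of `L` and
the top is the bottom of `L`. -/
instance : SemilatticeInf (CompactElt L) where
  le k l := l.val ≤ k.val
  le_refl _ := le_rfl
  le_trans _ _ _ h h' := h'.trans h
  le_antisymm _ _ h h' := CompactElt.ext (le_antisymm h' h)
  inf k l := ⟨k.val ⊔ l.val, compact_sup k.isCompact l.isCompact⟩
  inf_le_left _ _ := le_sup_left
  inf_le_right _ _ := le_sup_right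
  le_inf _ _ _ h h' := sup_le h h'

instance : OrderTop (CompactElt L) where
  top := ⟨⊥, isCompactElement_bot⟩
  le_top _ := bot_le

theorem isDistribMeet_compactElt [IsCompactlyGenerated L] (hL : IsFrameLattice L) :
    IsDistribMeet (CompactElt L) := by
  intro a b c (h : c.val ≤ a.val ⊔ b.val)
  let S : Set L := {x | ∃ k l, IsCompactElement k ∧ IsCompactElement l ∧ k ≤ c.val ⊓ a.val ∧
    l ≤ c.val ⊓ b.val ∧ x = k ⊔ l}
  have hS : DirectedOn (· ≤ ·) S := by
    rintro _ ⟨k, l, hk, hl, h1, h2, rfl⟩ _ ⟨k', l', hk', hl', h1', h2', rfl⟩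
    exact ⟨_, ⟨k ⊔ k', l ⊔ l', compact_sup hk hk', compact_sup hl hl', sup_le h1 h1', sup_le h2 h2', rfl⟩,
      sup_le_sup le_sup_left le_sup_left, sup_le_sup le_sup_right le_sup_right⟩
  have hle : c.val ≤ sSup S := by
    have h1 : c.val ⊓ a.val ≤ sSup S := by
      rw [le_iff_compact_le_imp]
      exact fun k hk hka => le_sSup
        ⟨k, ⊥, hk, isCompactElement_bot, hka, bot_le, (sup_bot_eq k).symm⟩
    have h2 : c.val ⊓ b.val ≤ sSup S := by
      rw [le_iff_compact_le_imp]
      exact fun k hk hka => le_sSup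
        ⟨⊥, k, isCompactElement_bot, hk, bot_le, hka, (bot_sup_eq k).symm⟩
    calc c.val = c.val ⊓ (a.val ⊔ b.val) := (inf_eq_left.2 h).symm
      _ = _ := hL.inf_sup _ _ _
      _ ≤ _ := sup_le h1 h2
  obtain ⟨_, ⟨k, l, hk, hl, h1, h2, rfl⟩, hc⟩ :=
    (CompleteLattice.isCompactElement_iff_le_of_directed_sSup_le _ _).1 c.isCompact S
      ⟨⊥ ⊔ ⊥, ⊥, ⊥, isCompactElement_bot, isCompactElement_bot, bot_le, bot_le, rfl⟩ hS hle
  refine ⟨⟨k, hk⟩, ⟨l, hl⟩, h1.trans inf_le_right, h2.trans inf_le_right, CompactElt.ext ?_⟩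
  exact le_antisymm (sup_le (h1.trans inf_le_left) (h2.trans inf_le_left)) hc

end Compact

theorem AlgFrmJ.Hom.map_sup {L N : AlgFrmJ.{u}} (f : AlgFrmJ.Hom L N) (a b : L) :
    f.toFun (a ⊔ b) = f.toFun a ⊔ f.toFun b := by
  rw [← sSup_pair, f.map_sSup, Set.image_pair, sSup_pair]

theorem AlgFrmJ.Hom.map_bot {L N : AlgFrmJ.{u}} (f : AlgFrmJ.Hom L N) :
    f.toFun ⊥ = ⊥ := by
  rw [← sSup_empty, f.map_sSup, Set.image_empty, sSup_empty]

/-- The functor `𝓚`: it sends `L` to its compact elements under the dual order and a morphism to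
its restriction. -/
def compactFunctor : AlgFrmJ.{u} ⥤ DMS.{u} where
  obj L := { carrier := CompactElt L, distrib := isDistribMeet_compactElt L.frame }
  map {L N} f :=
    ({ toFun := fun k => ⟨f.toFun k.val, f.map_compact _ k.isCompact⟩
       map_inf' := fun k l => CompactElt.ext (f.map_sup k.val l.val)
       map_top' := CompactElt.ext f.map_bot } : InfTopHom (CompactElt L) (CompactElt N))
  map_id _ := rfl
  map_comp _ _ := rfl

/-! ### Admissible clopen upsets: the functor `𝓐` -/

section Admissible

variable {X Y : Type u} [TopologicalSpace X] [PartialOrder X] [TopologicalSpace Y] [PartialOrder Y]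

theorem isClosed_Ici_of_priestley [PriestleySpace X] (x : X) : IsClosed (Set.Ici x) := by
  rw [← isOpen_compl_iff, isOpen_iff_forall_mem_open]
  intro y hy
  obtain ⟨U, hU, hU', hx, hyU⟩ := PriestleySpace.priestley hy
  exact ⟨Uᶜ, fun z hz hxz => hz (hU' hxz hx), hU.compl.isOpen, hyU⟩

theorem exists_maximal_of_isClosed [CompactSpace X] [PriestleySpace X] {C : Set X}
    (hC : IsClosed C) {x : X} (hx : x ∈ C) : ∃ y, x ≤ y ∧ Maximal (· ∈ C) y := by
  refine zorn_le_nonempty₀ C (fun c hcC hc y hy => ?_) x hx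
  haveI : Nonempty c := ⟨⟨y, hy⟩⟩
  have hcl : ∀ i : c, IsClosed (Set.Ici (i : X) ∩ C) := fun i =>
    (isClosed_Ici_of_priestley (i : X)).inter hC
  obtain ⟨z, hz⟩ := IsCompact.nonempty_iInter_of_directed_nonempty_isCompact_isClosed
    (fun i : c => Set.Ici (i : X) ∩ C)
    (by
      rintro ⟨i, hi⟩ ⟨j, hj⟩
      rcases hc.total hi hj with h | h
      · exact ⟨⟨j, hj⟩, fun z hz => ⟨h.trans hz.1, hz.2⟩, fun z hz => hz⟩
      · exact ⟨⟨i, hi⟩, fun z hz => hz, fun z hz => ⟨h.trans hz.1, hz.2⟩⟩)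
    (fun i => ⟨i, le_rfl, hcC i.2⟩) (fun i => (hcl i).isCompact) hcl
  rw [Set.mem_iInter] at hz
  exact ⟨z, (hz ⟨y, hy⟩).2, fun i hi => (hz ⟨i, hi⟩).1⟩

theorem isAdmissible_of {X₀ U : Set X} (hU : IsClopen U) (hU' : IsUpperSet U)
    (h : ∀ x ∉ U, ∃ y ∈ X₀, y ∉ U ∧ x ≤ y) : IsAdmissible X₀ U where
  isClopen := hU
  isUpperSet := hU'
  maximal_mem x hx := by
    obtain ⟨y, hy, hyU, hxy⟩ := h x hx.1
    rwa [le_antisymm hxy (hx.2 hyU hxy)]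

theorem IsAdmissible.exists_le {X₀ U : Set X} {m : X} (h : IsPGPS X₀ m) (hU : IsAdmissible X₀ U)
    {x : X} (hx : x ∉ U) : ∃ y ∈ X₀, y ∉ U ∧ x ≤ y := by
  haveI := h.compact
  haveI := h.priestley
  obtain ⟨y, hxy, hy⟩ := exists_maximal_of_isClosed hU.isClopen.compl.isClosed (x := x) hx
  exact ⟨y, hU.maximal_mem y hy, hy.1, hxy⟩

theorem IsAdmissible.univ (X₀ : Set X) : IsAdmissible X₀ (Set.univ : Set X) where
  isClopen := isClopen_univ
  isUpperSet := isUpperSet_univ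
  maximal_mem x hx := absurd (Set.mem_univ x) hx.1

theorem IsAdmissible.inter {X₀ U V : Set X} (hU : IsAdmissible X₀ U) (hV : IsAdmissible X₀ V) :
    IsAdmissible X₀ (U ∩ V) where
  isClopen := hU.isClopen.inter hV.isClopen
  isUpperSet := hU.isUpperSet.inter hV.isUpperSet
  maximal_mem x hx := by
    by_cases hxU : x ∈ U
    · refine hV.maximal_mem x ⟨fun hxV => hx.1 ⟨hxU, hxV⟩, fun y hy hxy => ?_⟩
      exact hx.2 (fun h => hy h.2) hxy
    · refine hU.maximal_mem x ⟨hxU, fun y hy hxy => ?_⟩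
      exact hx.2 (fun h => hy h.1) hxy

/-- The admissible clopen upsets. -/
@[ext]
structure AdmClopen (X₀ : Set X) : Type u where
  carrier : Set X
  isAdmissible : IsAdmissible X₀ carrier

/-- Admissible clopen upsets are ordered by inclusion; meets are intersections. -/
instance (X₀ : Set X) : SemilatticeInf (AdmClopen X₀) where
  le U V := U.carrier ⊆ V.carrier
  le_refl _ := subset_rfl
  le_trans _ _ _ h h' := h.trans h'
  le_antisymm _ _ h h' := AdmClopen.ext (h.antisymm h')
  inf U V := ⟨U.carrier ∩ V.carrier, U.isAdmissible.inter V.isAdmissible⟩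
  inf_le_left _ _ := Set.inter_subset_left
  inf_le_right _ _ := Set.inter_subset_right
  le_inf _ _ _ h h' := Set.subset_inter h h'

instance (X₀ : Set X) : OrderTop (AdmClopen X₀) where
  top := ⟨Set.univ, IsAdmissible.univ X₀⟩
  le_top _ := Set.subset_univ _

theorem box_inter (R : X → Y → Prop) (U V : Set Y) : box R (U ∩ V) = box R U ∩ box R V := by
  ext x
  exact ⟨fun h => ⟨fun y hy => (h y hy).1, fun y hy => (h y hy).2⟩,
    fun h y hy => ⟨h.1 y hy, h.2 y hy⟩⟩

theorem box_univ (R : X → Y → Prop) : box R (Set.univ : Set Y) = Set.univ :=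
  Set.eq_univ_of_forall fun _ _ _ => Set.mem_univ _

/-! ### Admissible closed upsets: the functor `𝓥ᵃ` -/

/-- The admissible closed upsets: closed upsets `C` with `X ∖ C = ↓(X₀ ∖ C)`. -/
@[ext]
structure AdmClosed (X₀ : Set X) : Type u where
  carrier : Set X
  isClosed : IsClosed carrier
  isUpperSet : IsUpperSet carrier
  compl_eq : carrierᶜ = (lowerClosure (X₀ \ carrier) : Set X)

theorem compl_eq_lowerClosure {X₀ C : Set X} (hC : IsUpperSet C)
    (h : ∀ x ∉ C, ∃ y ∈ X₀, y ∉ C ∧ x ≤ y) : Cᶜ = (lowerClosure (X₀ \ C) : Set X) := by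
  ext x
  simp only [Set.mem_compl_iff, SetLike.mem_coe, mem_lowerClosure, Set.mem_sdiff]
  refine ⟨fun hx => ?_, fun ⟨y, hy, hxy⟩ hx => hy.2 (hC hxy hx)⟩
  obtain ⟨y, hy, hyC, hxy⟩ := h x hx
  exact ⟨y, ⟨hy, hyC⟩, hxy⟩

theorem AdmClosed.exists_le {X₀ : Set X} (C : AdmClosed X₀) {x : X} (hx : x ∉ C.carrier) :
    ∃ y ∈ X₀, y ∉ C.carrier ∧ x ≤ y := by
  have : x ∈ C.carrierᶜ := hx
  rw [C.compl_eq] at this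
  simp only [SetLike.mem_coe, mem_lowerClosure, Set.mem_sdiff] at this
  obtain ⟨y, hy, hxy⟩ := this
  exact ⟨y, hy.1, hy.2, hxy⟩

/-- Admissible closed upsets are ordered by *reverse* inclusion. -/
instance (X₀ : Set X) : PartialOrder (AdmClosed X₀) where
  le C D := D.carrier ⊆ C.carrier
  le_refl _ := subset_rfl
  le_trans _ _ _ h h' := h'.trans h
  le_antisymm _ _ h h' := AdmClosed.ext (h'.antisymm h)

theorem AdmClosed.le_def {X₀ : Set X} {C D : AdmClosed X₀} : C ≤ D ↔ D.carrier ⊆ C.carrier :=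
  Iff.rfl

/-- Joins are intersections. -/
instance (X₀ : Set X) : SupSet (AdmClosed X₀) where
  sSup S :=
    { carrier := ⋂ C ∈ S, C.carrier
      isClosed := isClosed_biInter fun C _ => C.isClosed
      isUpperSet := isUpperSet_iInter₂ fun C _ => C.isUpperSet
      compl_eq := compl_eq_lowerClosure (isUpperSet_iInter₂ fun C _ => C.isUpperSet) fun x hx => by
        simp only [Set.mem_iInter, not_forall] at hx
        obtain ⟨C, hC, hx⟩ := hx
        obtain ⟨y, hy, hyC, hxy⟩ := C.exists_le hx
        exact ⟨y, hy, fun h => hyC (Set.mem_iInter₂.1 h C hC), hxy⟩ }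

instance (X₀ : Set X) : CompleteLattice (AdmClosed X₀) :=
  completeLatticeOfSup (AdmClosed X₀) fun S =>
    ⟨fun C hC _ hx => Set.mem_iInter₂.1 hx C hC, fun _ hD _ hx => Set.mem_iInter₂.2 fun _ hC =>
      hD hC hx⟩

theorem AdmClosed.mem_sSup {X₀ : Set X} {S : Set (AdmClosed X₀)} {x : X} :
    x ∈ (sSup S).carrier ↔ ∀ C ∈ S, x ∈ C.carrier := Set.mem_iInter₂

/-- An admissible clopen upset is an admissible closed upset. -/
def AdmClosed.ofAdmissible {X₀ U : Set X} {m : X} (h : IsPGPS X₀ m) (hU : IsAdmissible X₀ U) :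
    AdmClosed X₀ where
  carrier := U
  isClosed := hU.isClopen.isClosed
  isUpperSet := hU.isUpperSet
  compl_eq := compl_eq_lowerClosure hU.isUpperSet fun _ hx => hU.exists_le h hx

theorem exists_missing_superset {X₀ : Set X} {z : X} (hz : DirectedOn (· ⊆ ·) (missing X₀ z))
    (hne : (missing X₀ z).Nonempty) {ι : Type*} (s : Finset ι) (U : ι → Set X)
    (hU : ∀ i ∈ s, U i ∈ missing X₀ z) : ∃ V ∈ missing X₀ z, ∀ i ∈ s, U i ⊆ V := by
  classical
  induction s using Finset.induction_on with
  | empty =>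
    obtain ⟨V, hV⟩ := hne
    exact ⟨V, hV, by simp⟩
  | insert a s _ ih =>
    obtain ⟨V, hV, h⟩ := ih fun i hi => hU i (Finset.mem_insert_of_mem hi)
    obtain ⟨W, hW, h1, h2⟩ := hz V hV (U a) (hU a (Finset.mem_insert_self a s))
    refine ⟨W, hW, fun i hi => ?_⟩
    rcases Finset.mem_insert.1 hi with rfl | hi
    · exact h2
    · exact (h i hi).trans h1

theorem AdmClosed.exists_admissible {X₀ : Set X} {m : X} (h : IsPGPS X₀ m) (C : AdmClosed X₀)
    {x : X} (hx : x ∉ C.carrier) : ∃ U, IsAdmissible X₀ U ∧ C.carrier ⊆ U ∧ x ∉ U := by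
  haveI := h.compact
  obtain ⟨z, hz, hzC, hxz⟩ := C.exists_le hx
  have key : ∀ c : C.carrier, ∃ U, IsAdmissible X₀ U ∧ (c : X) ∈ U ∧ z ∉ U := fun c => by
    have : ¬ (c : X) ≤ z := fun hcz => hzC (C.isUpperSet hcz c.2)
    rw [h.le_iff] at this
    push Not at this
    exact this
  choose U hU hcU hzU using key
  obtain ⟨t, ht⟩ := C.isClosed.isCompact.elim_finite_subcover U
    (fun c => (hU c).isClopen.isOpen) (fun c hc => Set.mem_iUnion.2 ⟨⟨c, hc⟩, hcU ⟨c, hc⟩⟩)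
  obtain ⟨hne, hdir⟩ := (h.mem_iff z).1 hz
  obtain ⟨V, hV, hVU⟩ := exists_missing_superset hdir hne t U fun i _ => ⟨hU i, hzU i⟩
  refine ⟨V, hV.1, fun c hc => ?_, fun hxV => hV.2 (hV.1.isUpperSet hxz hxV)⟩
  obtain ⟨i, hi, hci⟩ := Set.mem_iUnion₂.1 (ht hc)
  exact hVU i hi hci

theorem AdmClosed.isCompactElement_iff {X₀ : Set X} {m : X} (h : IsPGPS X₀ m)
    {C : AdmClosed X₀} : IsCompactElement C ↔ IsAdmissible X₀ C.carrier := by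
  haveI := h.compact
  rw [CompleteLattice.isCompactElement_iff_le_of_directed_sSup_le]
  refine ⟨fun hC => ?_, fun hC S hne hS hle => ?_⟩
  · obtain ⟨U, ⟨hU, hCU⟩, hle⟩ := hC {U | IsAdmissible X₀ U.carrier ∧ C.carrier ⊆ U.carrier}
      ⟨ofAdmissible h (.univ X₀), .univ X₀, Set.subset_univ _⟩
      (fun U hU V hV => ⟨ofAdmissible h (hU.1.inter hV.1),
        ⟨hU.1.inter hV.1, Set.subset_inter hU.2 hV.2⟩, Set.inter_subset_left,
        Set.inter_subset_right⟩)
      (fun x hx => by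
        by_contra hxC
        obtain ⟨U, hU, hCU, hxU⟩ := C.exists_admissible h hxC
        exact hxU (mem_sSup.1 hx (ofAdmissible h hU) ⟨hU, hCU⟩))
    have : C = U := le_antisymm hle hCU
    rwa [this]
  · haveI : Nonempty S := hne.to_subtype
    obtain ⟨D, hD⟩ := exists_subset_nhds_of_isCompact' (V := fun D : S => D.1.carrier)
      (by
        rintro ⟨D, hD⟩ ⟨E, hE⟩
        obtain ⟨G, hG, h1, h2⟩ := hS D hD E hE
        exact ⟨⟨G, hG⟩, h1, h2⟩)
      (fun D => D.1.isClosed.isCompact) (fun D => D.1.isClosed) (U := C.carrier)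
      (fun x hx => hC.isClopen.isOpen.mem_nhds (hle (mem_sSup.2 fun D hD =>
        Set.mem_iInter.1 hx ⟨D, hD⟩)))
    exact ⟨D.1, D.2, hD⟩

theorem AdmClosed.isCompactlyGenerated {X₀ : Set X} {m : X} (h : IsPGPS X₀ m) :
    IsCompactlyGenerated (AdmClosed X₀) where
  exists_sSup_eq C := by
    refine ⟨{U | IsAdmissible X₀ U.carrier ∧ C.carrier ⊆ U.carrier},
      fun U hU => (isCompactElement_iff h).2 hU.1,
      le_antisymm (sSup_le fun U hU => hU.2) fun x hx => ?_⟩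
    by_contra hxC
    obtain ⟨U, hU, hCU, hxU⟩ := C.exists_admissible h hxC
    exact hxU (mem_sSup.1 hx (ofAdmissible h hU) ⟨hU, hCU⟩)

theorem AdmClosed.isFrameLattice {X₀ : Set X} {m : X} (h : IsPGPS X₀ m) :
    IsFrameLattice (AdmClosed X₀) := by
  intro C S
  refine le_antisymm ?_ (iSup₂_le fun D hD => inf_le_inf_left _ (le_sSup hD))
  intro x hx
  by_contra hxC
  obtain ⟨y, hy, hyC, hxy⟩ := (C ⊓ sSup S).exists_le hxC
  have hy1 : y ∉ C.carrier := fun h' => hyC ((inf_le_left : C ⊓ sSup S ≤ C) h')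
  have hy2 : y ∉ (sSup S).carrier := fun h' => hyC ((inf_le_right : C ⊓ sSup S ≤ sSup S) h')
  rw [mem_sSup] at hy2
  push Not at hy2
  obtain ⟨D, hD, hyD⟩ := hy2
  obtain ⟨U, hU, hCU, hyU⟩ := C.exists_admissible h hy1
  obtain ⟨V, hV, hDV, hyV⟩ := D.exists_admissible h hyD
  obtain ⟨W, hW, hUW, hVW⟩ := ((h.mem_iff y).1 hy).2 U ⟨hU, hyU⟩ V ⟨hV, hyV⟩
  have h1 : ofAdmissible h hW.1 ≤ C ⊓ D := le_inf (hCU.trans hUW) (hDV.trans hVW)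
  have h2 : C ⊓ D ≤ ⨆ s ∈ S, C ⊓ s := le_iSup₂_of_le D hD le_rfl
  exact hW.2 (hW.1.isUpperSet hxy (h1 (h2 hx)))

theorem isDistribMeet_admClopen {X₀ : Set X} {m : X} (h : IsPGPS X₀ m) :
    IsDistribMeet (AdmClopen X₀) := by
  intro U V W hUVW
  haveI := AdmClosed.isCompactlyGenerated h
  let f : AdmClopen X₀ → CompactElt (AdmClosed X₀) := fun U =>
    ⟨AdmClosed.ofAdmissible h U.isAdmissible, (AdmClosed.isCompactElement_iff h).2 U.isAdmissible⟩
  have hinf : ∀ C D : AdmClosed X₀, (C ⊔ D).carrier = C.carrier ∩ D.carrier := fun C D => by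
    ext x
    rw [← sSup_pair, AdmClosed.mem_sSup]
    simp
  obtain ⟨a, b, ha, hb, hab⟩ := isDistribMeet_compactElt (AdmClosed.isFrameLattice h)
    (f U) (f V) (f W) (by
      show (f W).val ≤ (f U).val ⊔ (f V).val
      rw [AdmClosed.le_def, hinf]
      exact hUVW)
  refine ⟨⟨a.val.carrier, (AdmClosed.isCompactElement_iff h).1 a.isCompact⟩,
    ⟨b.val.carrier, (AdmClosed.isCompactElement_iff h).1 b.isCompact⟩, ha, hb, ?_⟩
  apply AdmClopen.ext
  have := congrArg (fun k : CompactElt (AdmClosed X₀) => k.val.carrier) hab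
  exact (hinf a.val b.val).symm.trans this

/-- `□_R` on admissible closed upsets. -/
def AdmClosed.box {X₀ : Set X} {Y₀ : Set Y} {m : X} {n : Y} (hX : IsPGPS X₀ m) (hY : IsPGPS Y₀ n)
    {R : X → Y → Prop} (hR : IsGPMorphism X₀ Y₀ R) (C : AdmClosed Y₀) : AdmClosed X₀ :=
  have key : GenPriestley.box R C.carrier = (sSup {D : AdmClosed X₀ | ∃ U, IsAdmissible Y₀ U ∧
      C.carrier ⊆ U ∧ D.carrier = GenPriestley.box R U}).carrier := by
    ext x
    rw [mem_sSup]
    constructor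
    · rintro hx D ⟨U, -, hCU, hD⟩
      rw [hD]
      exact fun y hy => hCU (hx y hy)
    · intro hx y hy
      by_contra hyC
      obtain ⟨U, hU, hCU, hyU⟩ := C.exists_admissible hY hyC
      exact hyU (hx (ofAdmissible hX (hR.box_admissible U hU)) ⟨U, hU, hCU, rfl⟩ y hy)
  { carrier := GenPriestley.box R C.carrier
    isClosed := key ▸ AdmClosed.isClosed _
    isUpperSet := key ▸ AdmClosed.isUpperSet _
    compl_eq := key ▸ AdmClosed.compl_eq _ }

end Admissible

/-- The contravariant functor `𝓐`: it sends `X` to its admissible clopen upsets and `R` to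
`□_R`. -/
def admFunctor : PGPS.{u}ᵒᵖ ⥤ DMS.{u} where
  obj X := { carrier := AdmClopen X.unop.dom, distrib := isDistribMeet_admClopen X.unop.isPGPS }
  map {Y X} R :=
    ({ toFun := fun U => ⟨box R.unop.rel U.carrier,
          R.unop.isGPMorphism.box_admissible _ U.isAdmissible⟩
       map_inf' := fun U V => AdmClopen.ext (box_inter _ _ _)
       map_top' := AdmClopen.ext (box_univ _) } :
      InfTopHom (AdmClopen Y.unop.dom) (AdmClopen X.unop.dom))
  map_id X := DFunLike.ext (F := InfTopHom (AdmClopen X.unop.dom) (AdmClopen X.unop.dom)) _ _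
    fun U => AdmClopen.ext (box_le U.isAdmissible.isUpperSet)
  map_comp {X _ Z} R S :=
    DFunLike.ext (F := InfTopHom (AdmClopen X.unop.dom) (AdmClopen Z.unop.dom)) _ _
      fun U => AdmClopen.ext (box_starComp _ _ U.isAdmissible)

/-- The contravariant functor `𝓥ᵃ`: it sends `X` to its admissible closed upsets and `R` to
`□_R`. -/
def vietorisFunctor : PGPS.{u}ᵒᵖ ⥤ AlgFrmJ.{u} where
  obj X :=
    { carrier := AdmClosed X.unop.dom
      algebraic := AdmClosed.isCompactlyGenerated X.unop.isPGPS
      frame := AdmClosed.isFrameLattice X.unop.isPGPS }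
  map {Y X} R :=
    { toFun := AdmClosed.box X.unop.isPGPS Y.unop.isPGPS R.unop.isGPMorphism
      map_sSup := fun S => by
        apply AdmClosed.ext
        ext x
        rw [AdmClosed.mem_sSup]
        constructor
        · rintro hx _ ⟨C, hC, rfl⟩ y hy
          exact AdmClosed.mem_sSup.1 (hx y hy) C hC
        · intro hx y hy
          exact AdmClosed.mem_sSup.2 fun C hC => hx _ ⟨C, hC, rfl⟩ y hy
      map_compact := fun C hC => (AdmClosed.isCompactElement_iff X.unop.isPGPS).2
        (R.unop.isGPMorphism.box_admissible _
          ((AdmClosed.isCompactElement_iff Y.unop.isPGPS).1 hC)) }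
  map_id X := by
    apply AlgFrmJ.Hom.ext
    funext C
    exact AdmClosed.ext (box_le (AdmClosed.isUpperSet C))
  map_comp {X Y Z} R S := by
    apply AlgFrmJ.Hom.ext
    funext C
    apply AdmClosed.ext
    ext z
    constructor
    · intro hz y hy x hx
      exact hz x (starComp_of hy hx)
    · intro hz x hx
      by_contra hxC
      obtain ⟨U, hU, hCU, hxU⟩ := AdmClosed.exists_admissible X.unop.isPGPS C hxC
      exact hxU (hx U hU fun y hy x hx => hCU (hz y hy x hx))

/-! ### Pseudoprime elements: the functor `𝓨` -/

section Pseudoprime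

variable {L N : Type u} [CompleteLattice L] [CompleteLattice N]

/-- The way-below relation. -/
def WayBelow (a b : L) : Prop :=
  ∀ S : Set L, b ≤ sSup S → ∃ T ⊆ S, T.Finite ∧ a ≤ sSup T

/-- Pseudoprime elements: `p ≠ 1` and `a₁ ∧ ⋯ ∧ aₙ ≪ p` implies `aᵢ ≤ p` for some `i`. -/
def IsPseudoprime (p : L) : Prop :=
  p ≠ ⊤ ∧ ∀ A : Finset L, WayBelow (A.inf id) p → ∃ a ∈ A, a ≤ p

theorem WayBelow.le {a b : L} (h : WayBelow a b) : a ≤ b := by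
  obtain ⟨T, hT, -, ha⟩ := h {b} (by simp)
  exact ha.trans (sSup_le fun x hx => (hT hx).le)

theorem wayBelow_of_le_compact {a k b : L} (hk : IsCompactElement k) (h : a ≤ k) (h' : k ≤ b) :
    WayBelow a b := by
  intro S hS
  obtain ⟨T, hT, hk⟩ := (CompleteLattice.isCompactElement_iff_exists_le_sSup_of_le_sSup _ k).1 hk S
    (h'.trans hS)
  exact ⟨T, hT, T.finite_toSet, h.trans (by rwa [Finset.sup_id_eq_sSup] at hk)⟩

theorem WayBelow.exists_compact [IsCompactlyGenerated L] {a b : L} (h : WayBelow a b) :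
    ∃ k, IsCompactElement k ∧ a ≤ k ∧ k ≤ b := by
  obtain ⟨T, hT, hfin, ha⟩ := h {k | IsCompactElement k ∧ k ≤ b} (sSup_compact_le_eq b).ge
  refine ⟨sSup T, ?_, ha, sSup_le fun x hx => (hT hx).2⟩
  have := CompleteLattice.isCompactElement_finsetSup (f := id) hfin.toFinset
    (fun x hx => (hT (hfin.mem_toFinset.1 hx)).1)
  rwa [Finset.sup_id_eq_sSup, hfin.coe_toFinset] at this

theorem infPrime_finset {p : L} (hp : InfPrime p) {A : Finset L} (h : A.inf id ≤ p) :
    ∃ a ∈ A, a ≤ p := by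
  classical
  induction A using Finset.induction_on with
  | empty => exact absurd (isMax_iff_eq_top.2 (top_le_iff.1 h)) hp.1
  | insert a A _ ih =>
    rw [Finset.inf_insert] at h
    rcases hp.2 h with h | h
    · exact ⟨a, Finset.mem_insert_self a A, h⟩
    · obtain ⟨b, hb, hbp⟩ := ih h
      exact ⟨b, Finset.mem_insert_of_mem hb, hbp⟩

theorem infPrime_ne_top {p : L} (hp : InfPrime p) : p ≠ ⊤ := fun h => hp.1 (isMax_iff_eq_top.2 h)

theorem IsPseudoprime.of_infPrime {p : L} (hp : InfPrime p) : IsPseudoprime p :=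
  ⟨infPrime_ne_top hp, fun _ h => infPrime_finset hp h.le⟩

/-- In an algebraic frame, distinct elements are separated by primes. -/
theorem exists_infPrime [IsCompactlyGenerated L] (hL : IsFrameLattice L) {a b : L}
    (hab : ¬ a ≤ b) : ∃ p, InfPrime p ∧ b ≤ p ∧ ¬ a ≤ p := by
  obtain ⟨k, hk, hka, hkb⟩ := exists_compact_not_le hab
  obtain ⟨p, hbp, hp⟩ := zorn_le_nonempty₀ {x : L | ¬ k ≤ x} (fun c hc hchain y hy => by
    refine ⟨sSup c, fun hkc => ?_, fun z hz => le_sSup hz⟩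
    obtain ⟨x, hx, hkx⟩ := (CompleteLattice.isCompactElement_iff_le_of_directed_sSup_le _ _).1 hk c
      ⟨y, hy⟩ hchain.directedOn hkc
    exact hc hx hkx) b hkb
  have hkp : ¬ k ≤ p := hp.1
  refine ⟨p, ⟨fun hmax => hkp ((isMax_iff_eq_top.1 hmax).symm ▸ le_top), fun x y hxy => ?_⟩, hbp,
    fun hap => hkp (hka.trans hap)⟩
  by_contra! hcon
  have aux : ∀ z, ¬ z ≤ p → k ≤ p ⊔ z := fun z hz => by
    by_contra hkz
    exact hz (le_sup_right.trans (hp.2 hkz le_sup_left))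
  exact hkp (((le_inf (aux x hcon.1) (aux y hcon.2)).trans (hL.sup_inf_le p x y)).trans
    (sup_le le_rfl hxy))

/-- The topology on an algebraic lattice generated by the sets `↑k` and their complements,
for `k` compact. -/
@[reducible]
def patchTopology (L : Type u) [CompleteLattice L] : TopologicalSpace L :=
  TopologicalSpace.generateFrom
    ({U | ∃ k, IsCompactElement k ∧ U = Set.Ici k} ∪
      {U | ∃ k, IsCompactElement k ∧ U = (Set.Ici k)ᶜ})

/-- `Y_L`: the pseudoprime elements together with the top. -/
def ySet (L : Type u) [CompleteLattice L] : Set L := {p | IsPseudoprime p} ∪ {⊤}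

/-- `Y_L` carries the subspace topology. -/
instance : TopologicalSpace (ySet L) := (patchTopology L).induced Subtype.val

/-- `P(L)`, as a subset of `Y_L`. -/
def yPrimes (L : Type u) [CompleteLattice L] : Set (ySet L) := {p | InfPrime p.1}

/-- The point `1` of `Y_L`. -/
def yTop (L : Type u) [CompleteLattice L] : ySet L := ⟨⊤, Or.inr rfl⟩

theorem isOpen_up {k : L} (hk : IsCompactElement k) : IsOpen {y : ySet L | k ≤ y.1} :=
  letI := patchTopology L
  ⟨Set.Ici k, .basic _ (Or.inl ⟨k, hk, rfl⟩), rfl⟩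

theorem isClopen_up {k : L} (hk : IsCompactElement k) : IsClopen {y : ySet L | k ≤ y.1} :=
  letI := patchTopology L
  ⟨⟨⟨(Set.Ici k)ᶜ, .basic _ (Or.inr ⟨k, hk, rfl⟩), rfl⟩⟩, isOpen_up hk⟩

theorem isUpperSet_up (a : L) : IsUpperSet {y : ySet L | a ≤ y.1} := fun _ _ h h' => le_trans h' h

/-- Basic neighbourhoods in the patch topology. -/
theorem exists_basic_nhds {U : Set L} (hU : @IsOpen L (patchTopology L) U) {q : L} (hq : q ∈ U) :
    ∃ t, IsCompactElement t ∧ t ≤ q ∧ ∃ F : Finset L, (∀ l ∈ F, IsCompactElement l ∧ ¬ l ≤ q) ∧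
      ∀ x, t ≤ x → (∀ l ∈ F, ¬ l ≤ x) → x ∈ U := by
  classical
  change TopologicalSpace.GenerateOpen _ U at hU
  induction hU with
  | basic s hs =>
    rcases hs with ⟨k, hk, rfl⟩ | ⟨k, hk, rfl⟩
    · exact ⟨k, hk, hq, ∅, by simp, fun x hx _ => hx⟩
    · exact ⟨⊥, isCompactElement_bot, bot_le, {k}, by simpa using ⟨hk, hq⟩,
        fun x _ hx => hx k (by simp)⟩
  | univ => exact ⟨⊥, isCompactElement_bot, bot_le, ∅, by simp, fun x _ _ => trivial⟩
  | inter s t _ _ ihs iht =>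
    obtain ⟨a, ha, haq, F, hF, h⟩ := ihs hq.1
    obtain ⟨b, hb, hbq, G, hG, h'⟩ := iht hq.2
    refine ⟨a ⊔ b, compact_sup ha hb, sup_le haq hbq, F ∪ G, fun l hl => ?_, fun x hx hl => ?_⟩
    · rcases Finset.mem_union.1 hl with hl | hl
      exacts [hF l hl, hG l hl]
    · exact ⟨h x (le_sup_left.trans hx) fun l hl' => hl l (Finset.mem_union_left _ hl'),
        h' x (le_sup_right.trans hx) fun l hl' => hl l (Finset.mem_union_right _ hl')⟩
  | sUnion S _ ih =>
    obtain ⟨s, hs, hqs⟩ := hq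
    obtain ⟨a, ha, haq, F, hF, h⟩ := ih s hs hqs
    exact ⟨a, ha, haq, F, hF, fun x hx hl => ⟨s, hs, h x hx hl⟩⟩

theorem exists_basic_nhds_ySet {U : Set (ySet L)} (hU : IsOpen U) {q : ySet L} (hq : q ∈ U) :
    ∃ t, IsCompactElement t ∧ t ≤ q.1 ∧ ∃ F : Finset L,
      (∀ l ∈ F, IsCompactElement l ∧ ¬ l ≤ q.1) ∧
        ∀ x : ySet L, t ≤ x.1 → (∀ l ∈ F, ¬ l ≤ x.1) → x ∈ U := by
  obtain ⟨V, hV, rfl⟩ := hU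
  obtain ⟨t, ht, htq, F, hF, h⟩ := exists_basic_nhds hV hq
  exact ⟨t, ht, htq, F, hF, fun x hx hl => h x.1 hx hl⟩

theorem compactSpace_ySet [IsCompactlyGenerated L] : CompactSpace (ySet L) := by
  rw [← isCompact_univ_iff, isCompact_iff_ultrafilter_le_nhds]
  intro 𝓕 _
  let D : Set L := {k | IsCompactElement k ∧ {y : ySet L | k ≤ y.1} ∈ 𝓕}
  have hD : DirectedOn (· ≤ ·) D := fun a ha b hb => ⟨a ⊔ b, ⟨compact_sup ha.1 hb.1, by
    filter_upwards [ha.2, hb.2] with y h1 h2 using sup_le h1 h2⟩, le_sup_left, le_sup_right⟩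
  have hDne : D.Nonempty := ⟨⊥, isCompactElement_bot, 
    Filter.univ_mem' (f := (𝓕 : Filter (ySet L))) fun _ => bot_le⟩
  have hmem : ∀ k, IsCompactElement k → (k ≤ sSup D ↔ {y : ySet L | k ≤ y.1} ∈ 𝓕) := by
    refine fun k hk => ⟨fun h => ?_, fun h => le_sSup ⟨hk, h⟩⟩
    obtain ⟨l, hl, hkl⟩ :=
      (CompleteLattice.isCompactElement_iff_le_of_directed_sSup_le _ _).1 hk D hDne hD h
    filter_upwards [hl.2] with y hy using hkl.trans hy
  have hmem' : ∀ k, IsCompactElement k → ¬ k ≤ sSup D → {y : ySet L | ¬ k ≤ y.1} ∈ 𝓕 := by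
    intro k hk h
    rw [hmem k hk] at h
    exact Ultrafilter.compl_mem_iff_notMem.2 h
  have hp : sSup D ∈ ySet L := by
    by_cases htop : sSup D = ⊤
    · exact Or.inr htop
    refine Or.inl ⟨htop, fun A hA => ?_⟩
    by_contra! hcon
    obtain ⟨t, ht, hAt, htp⟩ := hA.exists_compact
    have hk : ∀ a : A, ∃ k, IsCompactElement k ∧ k ≤ a.1 ∧ ¬ k ≤ sSup D := fun a =>
      exists_compact_not_le (hcon a.1 a.2)
    choose k hkc hka hkp using hk
    have hall : {y : ySet L | ∀ a : A, ¬ k a ≤ y.1} ∈ 𝓕 := by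
      have := (Filter.iInter_mem (f := (𝓕 : Filter (ySet L)))).2 fun a => hmem' (k a) (hkc a) (hkp a)
      exact Filter.mem_of_superset this fun y hy a => Set.mem_iInter.1 hy a
    obtain ⟨y, hty, hy⟩ := 𝓕.nonempty_of_mem (Filter.inter_mem ((hmem t ht).1 htp) hall)
    classical
    have hle : (Finset.univ.image k).inf id ≤ t := by
      refine le_trans (Finset.le_inf fun a ha => ?_) hAt
      have h1 : (Finset.univ.image k).inf id ≤ id (k ⟨a, ha⟩) :=
        Finset.inf_le (Finset.mem_image_of_mem k (Finset.mem_univ _))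
      exact h1.trans (hka ⟨a, ha⟩)
    rcases y.2 with hyp | hyp
    · obtain ⟨_, hb, hby⟩ := hyp.2 _ (wayBelow_of_le_compact ht hle hty)
      obtain ⟨a, -, rfl⟩ := Finset.mem_image.1 hb
      exact hy a hby
    · rcases A.eq_empty_or_nonempty with rfl | ⟨a, ha⟩
      · exact htop (top_le_iff.1 (hAt.trans htp))
      · exact hy ⟨a, ha⟩ (le_of_le_of_eq le_top hyp.symm)
  refine ⟨⟨sSup D, hp⟩, trivial, fun U hU => ?_⟩
  obtain ⟨V, hVU, hV, hpV⟩ := mem_nhds_iff.1 hU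
  obtain ⟨t, ht, htp, F, hF, h⟩ := exists_basic_nhds_ySet hV hpV
  have hFmem : (⋂ l ∈ F, {y : ySet L | ¬ l ≤ y.1}) ∈ (𝓕 : Filter (ySet L)) :=
    (Filter.biInter_finset_mem F).2 fun l hl => hmem' l (hF l hl).1 (hF l hl).2
  refine Filter.mem_of_superset (Filter.inter_mem ((hmem t ht).1 htp) hFmem) fun y hy => hVU ?_
  exact h y hy.1 fun l hl => Set.mem_iInter₂.1 hy.2 l hl

theorem priestleySpace_ySet [IsCompactlyGenerated L] : PriestleySpace (ySet L) where
  priestley {x y} h := by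
    obtain ⟨k, hk, hkx, hky⟩ := exists_compact_not_le (show ¬ x.1 ≤ y.1 from h)
    exact ⟨_, isClopen_up hk, isUpperSet_up k, hkx, hky⟩

/-- If an open set contains `↑c ∩ Y_L` then it contains `↑t ∩ Y_L` for some compact `t ≤ c`. -/
theorem exists_compact_up_subset [IsCompactlyGenerated L] (c : L) {U : Set (ySet L)}
    (hU : IsOpen U) (h : ∀ y : ySet L, c ≤ y.1 → y ∈ U) :
    ∃ t, IsCompactElement t ∧ t ≤ c ∧ ∀ y : ySet L, t ≤ y.1 → y ∈ U := by
  have := compactSpace_ySet (L := L)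
  have : Nonempty {k : L | IsCompactElement k ∧ k ≤ c} := ⟨⟨⊥, isCompactElement_bot, bot_le⟩⟩
  obtain ⟨k, hk⟩ := exists_subset_nhds_of_isCompact'
    (V := fun k : {k : L | IsCompactElement k ∧ k ≤ c} => {y : ySet L | k.1 ≤ y.1})
    (by
      rintro ⟨a, ha⟩ ⟨b, hb⟩
      obtain ⟨d, hd, h1, h2⟩ := directedOn_compact_le c a ha b hb
      exact ⟨⟨d, hd⟩, fun y hy => h1.trans hy, fun y hy => h2.trans hy⟩)
    (fun k => (isClopen_up k.2.1).isClosed.isCompact) (fun k => (isClopen_up k.2.1).isClosed)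
    (U := U) (fun y hy => hU.mem_nhds (h y (by
      rw [le_iff_compact_le_imp]
      exact fun k hk hkc => Set.mem_iInter.1 hy ⟨k, hk, hkc⟩)))
  exact ⟨k.1, k.2.1, k.2.2, hk⟩

theorem isAdmissible_up [IsCompactlyGenerated L] (hL : IsFrameLattice L) {k : L}
    (hk : IsCompactElement k) : IsAdmissible (yPrimes L) {y : ySet L | k ≤ y.1} :=
  isAdmissible_of (isClopen_up hk) (isUpperSet_up k) fun x hx => by
    obtain ⟨p, hp, hxp, hkp⟩ := exists_infPrime hL hx
    exact ⟨⟨p, Or.inl (.of_infPrime hp)⟩, hp, hkp, hxp⟩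

theorem isAdmissible_ySet_iff [IsCompactlyGenerated L] (hL : IsFrameLattice L)
    {U : Set (ySet L)} :
    IsAdmissible (yPrimes L) U ↔ ∃ k, IsCompactElement k ∧ U = {y : ySet L | k ≤ y.1} := by
  classical
  refine ⟨fun hU => ?_, ?_⟩
  · have := compactSpace_ySet (L := L)
    have := priestleySpace_ySet (L := L)
    have key : ∀ u : U, ∃ k, IsCompactElement k ∧ k ≤ u.1.1 ∧ ∀ y : ySet L, k ≤ y.1 → y ∈ U :=
      fun u => exists_compact_up_subset u.1.1 hU.isClopen.isOpen
        fun y hy => hU.isUpperSet (show u.1 ≤ y from hy) u.2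
    choose k hk hku hkU using key
    obtain ⟨s, hs⟩ := hU.isClopen.isClosed.isCompact.elim_finite_subcover
      (fun u : U => {y : ySet L | k u ≤ y.1}) (fun u => isOpen_up (hk u))
      (fun u hu => Set.mem_iUnion.2 ⟨⟨u, hu⟩, hku ⟨u, hu⟩⟩)
    have hinf : ∀ y : ySet L, s.inf k ≤ y.1 → y ∈ U := by
      intro y hy
      by_contra hyU
      obtain ⟨p, hyp, hp⟩ := exists_maximal_of_isClosed hU.isClopen.compl.isClosed (x := y) hyU
      have hprime : InfPrime p.1 := hU.maximal_mem p hp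
      obtain ⟨b, hb, hbp⟩ := infPrime_finset (A := s.image k) hprime (by
        rw [Finset.inf_image]
        exact hy.trans hyp)
      obtain ⟨u, -, rfl⟩ := Finset.mem_image.1 hb
      exact hp.1 (hkU u p hbp)
    obtain ⟨t, ht, hts, h⟩ := exists_compact_up_subset (s.inf k) hU.isClopen.isOpen hinf
    refine ⟨t, ht, Set.Subset.antisymm (fun y hy => ?_) h⟩
    obtain ⟨u, hu, huy⟩ := Set.mem_iUnion₂.1 (hs hy)
    exact (hts.trans (Finset.inf_le hu)).trans huy
  · rintro ⟨k, hk, rfl⟩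
    exact isAdmissible_up hL hk

theorem isPGPS_ySet [IsCompactlyGenerated L] (hL : IsFrameLattice L) :
    IsPGPS (yPrimes L) (yTop L) where
  compact := compactSpace_ySet
  priestley := priestleySpace_ySet
  isTop y := show y.1 ≤ ⊤ from le_top
  subset := by
    rintro p hp rfl
    exact infPrime_ne_top hp rfl
  dense := by
    classical
    intro q hq
    rw [mem_closure_iff]
    intro U hU hqU
    obtain ⟨t, ht, htq, F, hF, h⟩ := exists_basic_nhds_ySet hU hqU
    have hqp : IsPseudoprime q.1 := by
      rcases q.2 with h | h
      · exact h
      · exact absurd (Subtype.ext (show q.1 = (yTop L).1 from h)) hq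
    have hnot : ¬ F.inf id ≤ t := fun hle => by
      obtain ⟨l, hl, hlq⟩ := hqp.2 F (wayBelow_of_le_compact ht hle htq)
      exact (hF l hl).2 hlq
    obtain ⟨p, hp, htp, hFp⟩ := exists_infPrime hL hnot
    exact ⟨⟨p, Or.inl (.of_infPrime hp)⟩, h _ htp fun l hl hlp => hFp ((Finset.inf_le hl).trans hlp),
      hp⟩
  order_dense x hx := by
    have : ¬ ⊤ ≤ x.1 := fun h => hx (Subtype.ext (top_le_iff.1 h))
    obtain ⟨p, hp, hxp, -⟩ := exists_infPrime hL this
    exact ⟨⟨p, Or.inl (.of_infPrime hp)⟩, hp, hxp⟩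
  mem_iff x := by
    constructor
    · intro hx
      have hx' : InfPrime x.1 := hx
      constructor
      · obtain ⟨k, hk, -, hkx⟩ :=
          exists_compact_not_le (fun h => infPrime_ne_top hx' (top_le_iff.1 h) : ¬ ⊤ ≤ x.1)
        exact ⟨_, isAdmissible_up hL hk, hkx⟩
      · rintro U ⟨hU, hxU⟩ V ⟨hV, hxV⟩
        obtain ⟨k, hk, rfl⟩ := (isAdmissible_ySet_iff hL).1 hU
        obtain ⟨l, hl, rfl⟩ := (isAdmissible_ySet_iff hL).1 hV
        have : ¬ k ⊓ l ≤ x.1 := fun h => (hx'.2 h).elim hxU hxV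
        obtain ⟨t, ht, htkl, htx⟩ := exists_compact_not_le this
        exact ⟨_, ⟨isAdmissible_up hL ht, htx⟩, fun y hy => (htkl.trans inf_le_left).trans hy,
          fun y hy => (htkl.trans inf_le_right).trans hy⟩
    · rintro ⟨⟨U, hU, hxU⟩, hdir⟩
      refine ⟨fun hmax => hxU ?_, fun a b hab => ?_⟩
      · obtain ⟨k, hk, rfl⟩ := (isAdmissible_ySet_iff hL).1 hU
        exact (le_top : k ≤ ⊤).trans (isMax_iff_eq_top.1 hmax).ge
      · by_contra! hcon
        obtain ⟨k, hk, hka, hkx⟩ := exists_compact_not_le hcon.1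
        obtain ⟨l, hl, hlb, hlx⟩ := exists_compact_not_le hcon.2
        obtain ⟨W, ⟨hW, hxW⟩, h1, h2⟩ := hdir _ ⟨isAdmissible_up hL hk, hkx⟩ _
          ⟨isAdmissible_up hL hl, hlx⟩
        obtain ⟨t, ht, rfl⟩ := (isAdmissible_ySet_iff hL).1 hW
        have aux : ∀ k : L, {y : ySet L | k ≤ y.1} ⊆ {y : ySet L | t ≤ y.1} → t ≤ k := by
          intro k hsub
          by_contra htk
          obtain ⟨p, hp, hkp, htp⟩ := exists_infPrime hL htk
          exact htp (hsub (show k ≤ (⟨p, Or.inl (.of_infPrime hp)⟩ : ySet L).1 from hkp))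
        exact hxW ((le_inf ((aux k h1).trans hka) ((aux l h2).trans hlb)).trans hab)
  le_iff x y := by
    refine ⟨fun h U hU hx => hU.isUpperSet h hx, fun h => ?_⟩
    show x.1 ≤ y.1
    rw [le_iff_compact_le_imp]
    exact fun k hk hkx => h _ (isAdmissible_up hL hk) hkx

/-- The right adjoint of a join-preserving map. -/
def rightAdj (f : L → N) (b : N) : L := sSup {a | f a ≤ b}

/-- The relation `R_α ⊆ Y_N × Y_L` of `α : L → N`: `p R_α q` iff `r(p) ≤ q`, where `r` is the right
adjoint of `α`. -/
def yRel (f : L → N) (p : ySet N) (q : ySet L) : Prop := rightAdj f p.1 ≤ q.1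

theorem gc_rightAdj {f : L → N} (hf : ∀ S : Set L, f (sSup S) = sSup (f '' S)) :
    GaloisConnection f (rightAdj f) := by
  have hmono : Monotone f := fun a b hab => by
    have := hf {a, b}
    rw [sSup_pair, sup_eq_right.2 hab, Set.image_pair, sSup_pair] at this
    rw [this]
    exact le_sup_left
  intro a b
  refine ⟨fun h => le_sSup h, fun h => (hmono h).trans ?_⟩
  rw [rightAdj, hf]
  exact sSup_le (by rintro _ ⟨c, hc, rfl⟩; exact hc)

theorem box_yRel [IsCompactlyGenerated L] (hL : IsFrameLattice L) {f : L → N}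
    (hf : ∀ S : Set L, f (sSup S) = sSup (f '' S)) (k : L) :
    box (yRel f) {y : ySet L | k ≤ y.1} = {y : ySet N | f k ≤ y.1} := by
  ext p
  constructor
  · intro h
    show f k ≤ p.1
    rw [gc_rightAdj hf k p.1]
    by_contra hcon
    obtain ⟨q, hq, hpq, hkq⟩ := exists_infPrime hL hcon
    exact hkq (h ⟨q, Or.inl (.of_infPrime hq)⟩ hpq)
  · intro h q hq
    exact ((gc_rightAdj hf k p.1).1 h).trans hq

theorem isGPMorphism_yRel [IsCompactlyGenerated L] [IsCompactlyGenerated N]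
    (hL : IsFrameLattice L) (hN : IsFrameLattice N) {f : L → N}
    (hf : ∀ S : Set L, f (sSup S) = sSup (f '' S))
    (hf' : ∀ k, IsCompactElement k → IsCompactElement (f k)) :
    IsGPMorphism (yPrimes N) (yPrimes L) (yRel f) where
  separated p q h := by
    obtain ⟨k, hk, hkp, hkq⟩ := exists_compact_not_le h
    exact ⟨_, isAdmissible_up hL hk, fun z hz => hkp.trans hz, hkq⟩
  box_admissible U hU := by
    obtain ⟨k, hk, rfl⟩ := (isAdmissible_ySet_iff hL).1 hU
    rw [box_yRel hL hf]
    exact isAdmissible_up hN (hf' k hk)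

end Pseudoprime

/-- The contravariant functor `𝓨`: it sends `L` to `⟨Y_L, τ, ≤, P(L), 1⟩` and `α` to `R_α`. -/
def yFunctor : AlgFrmJ.{u} ⥤ PGPS.{u}ᵒᵖ where
  obj L := .op
    { carrier := ySet L
      dom := yPrimes L
      pt := yTop L
      isPGPS := isPGPS_ySet L.frame }
  map {L N} f := Quiver.Hom.op
    ({ rel := yRel f.toFun
       isGPMorphism := isGPMorphism_yRel L.frame N.frame f.map_sSup f.map_compact } : PGPS.Hom _ _)
  map_id L := by
    apply Quiver.Hom.unop_inj
    apply PGPS.Hom.ext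
    funext p q
    show (sSup {a | a ≤ p.1} ≤ q.1) = (p.1 ≤ q.1)
    have : sSup {a | a ≤ p.1} = p.1 := le_antisymm (sSup_le fun _ h => h) (le_sSup le_rfl)
    rw [this]
  map_comp {L N K} f g := by
    apply Quiver.Hom.unop_inj
    apply PGPS.Hom.ext
    funext p q
    apply propext
    have hgf := (isGPMorphism_yRel L.frame K.frame (f ≫ g).map_sSup (f ≫ g).map_compact).iff_forall
      p q
    refine hgf.trans (forall₂_congr fun U hU => ?_)
    obtain ⟨k, hk, rfl⟩ := (isAdmissible_ySet_iff L.frame).1 hU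
    rw [box_yRel L.frame (f ≫ g).map_sSup]
    show _ ↔ (p ∈ box (yRel g.toFun) (box (yRel f.toFun) {y : ySet L | k ≤ y.1}) → _)
    rw [box_yRel L.frame f.map_sSup, box_yRel N.frame g.map_sSup]
    rfl

/-! ### Distributive envelopes and optimal filters: the functor `𝓧` -/

/-- Sup-homomorphisms: maps that preserve all finite meets and all *existing* finite joins (the
empty meet and the empty join included). Between lattices these are the lattice homomorphisms
which preserve the top, and the bottom whenever the domain has one. -/
structure IsSupHom {M N : Type u} [SemilatticeInf M] [OrderTop M] [SemilatticeInf N] [OrderTop N]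
    (f : M → N) : Prop where
  map_top : f ⊤ = ⊤
  map_inf : ∀ a b, f (a ⊓ b) = f a ⊓ f b
  map_isLUB : ∀ (S : Set M) (c : M), S.Finite → IsLUB S c → IsLUB (f '' S) (f c)

/-- `e : M → D` exhibits the distributive lattice `D` as the distributive envelope of `M`: it is
the universal sup-homomorphism from `M` to a distributive lattice with top, that is, the unit at
`M` of the left adjoint of the forgetful functor from distributive lattices. If `M` has a bottom,
then so has the target of every sup-homomorphism defined on `M`, and `D` is the envelope of `M`
among bounded distributive lattices. -/
structure IsDistribEnvelope {M D : Type u} [SemilatticeInf M] [OrderTop M] [DistribLattice D]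
    [OrderTop D] (e : M → D) : Prop where
  isSupHom : IsSupHom e
  existsUnique_lift : ∀ (E : Type u) [DistribLattice E] [OrderTop E] (f : M → E), IsSupHom f →
    ∃! g : D → E, IsSupHom g ∧ g ∘ e = f

section Optimal

variable {M N : Type u} [SemilatticeInf M] [OrderTop M] [SemilatticeInf N] [OrderTop N]

/-- Prime filters: proper filters `P` such that `F ∩ G ⊆ P` implies `F ⊆ P` or `G ⊆ P` for all
filters `F`, `G`. -/
def IsPrimeFilter (P : PFilter M) : Prop :=
  P ≠ ⊤ ∧ ∀ F G : PFilter M, (F : Set M) ∩ (G : Set M) ⊆ (P : Set M) →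
    (F : Set M) ⊆ (P : Set M) ∨ (G : Set M) ⊆ (P : Set M)

/-- Optimal filters: the restrictions to `M` of the prime filters of the distributive envelope
of `M`. -/
def IsOptimal (F : PFilter M) : Prop :=
  ∃ (D : Type u) (_ : DistribLattice D) (_ : OrderTop D) (e : M → D), IsDistribEnvelope e ∧
    ∃ P : PFilter D, IsPrimeFilter P ∧ ∀ a, a ∈ F ↔ e a ∈ P

theorem isPrimeFilter_iff {P : PFilter M} : IsPrimeFilter P ↔ InfPrime P := by
  have hinf : ∀ F G : PFilter M, (F : Set M) ∩ (G : Set M) ⊆ (P : Set M) ↔ F ⊓ G ≤ P :=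
    fun F G => ⟨fun h a ha => h (mem_inf_filter.1 ha), fun h a ha => h (mem_inf_filter.2 ha)⟩
  refine and_congr (not_congr isMax_iff_eq_top.symm) (forall₂_congr fun F G => ?_)
  rw [hinf]
  rfl

/-- Filters whose characteristic map to `{0, 1}` preserves existing finite joins. -/
def IsSupFilter (F : PFilter M) : Prop :=
  ∀ (S : Set M) (c : M), S.Finite → IsLUB S c → c ∈ F → ∃ a ∈ S, a ∈ F

theorem mem_finset_inf_filter {A : Finset (PFilter M)} {a : M} :
    a ∈ A.inf id ↔ ∀ F ∈ A, a ∈ F := by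
  rw [← PFilter.principal_le_iff, Finset.le_inf_iff]
  exact forall₂_congr fun F _ => PFilter.principal_le_iff

theorem mem_principal_filter {a b : M} : b ∈ PFilter.principal a ↔ a ≤ b := Iff.rfl

theorem IsPseudoprime.isSupFilter {F : PFilter M} (hF : IsPseudoprime F) : IsSupFilter F := by
  classical
  intro S c hS hc hcF
  obtain ⟨G, hG, hGF⟩ := hF.2 (hS.toFinset.image PFilter.principal)
    (wayBelow_of_le_compact (isCompactElement_principal c) (fun x hx => by
      rw [mem_finset_inf_filter] at hx
      refine hc.2 fun a ha => ?_
      exact hx (PFilter.principal a) (Finset.mem_image_of_mem _ (hS.mem_toFinset.2 ha)))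
      (PFilter.principal_le_iff.2 hcF))
  obtain ⟨a, ha, rfl⟩ := Finset.mem_image.1 hG
  exact ⟨a, hS.mem_toFinset.1 ha, PFilter.principal_le_iff.1 hGF⟩

theorem exists_primeFilter (hM : IsDistribMeet M) {F : PFilter M} {a : M} (ha : a ∉ F) :
    ∃ P : PFilter M, InfPrime P ∧ F ≤ P ∧ a ∉ P := by
  obtain ⟨P, hP, hFP, haP⟩ := exists_infPrime (isFrameLattice_filter hM)
    (fun h => ha (PFilter.principal_le_iff.1 h) : ¬ PFilter.principal a ≤ F)
  exact ⟨P, hP, hFP, fun h => haP (PFilter.principal_le_iff.2 h)⟩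

theorem isLUB_inf_image (hM : IsDistribMeet M) {S : Set M} (hS : S.Finite) {c : M}
    (h : ∀ u ∈ upperBounds S, c ≤ u) : IsLUB ((fun a => c ⊓ a) '' S) c := by
  classical
  refine ⟨by rintro _ ⟨a, -, rfl⟩; exact inf_le_left, fun u hu => ?_⟩
  by_contra hcu
  obtain ⟨P, hP, hcP, huP⟩ := exists_primeFilter hM (F := PFilter.principal c) (a := u) hcu
  obtain ⟨G, hG, hGP⟩ := infPrime_finset hP (A := hS.toFinset.image PFilter.principal)
    (fun x hx => by
      rw [mem_finset_inf_filter] at hx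
      exact hcP (h x fun a ha =>
        hx (PFilter.principal a) (Finset.mem_image_of_mem _ (hS.mem_toFinset.2 ha))))
  obtain ⟨a, ha, rfl⟩ := Finset.mem_image.1 hG
  refine huP (PFilter.mem_of_le (hu ⟨a, hS.mem_toFinset.1 ha, rfl⟩) (PFilter.inf_mem ?_ ?_))
  · exact hcP (mem_principal_filter.2 le_rfl)
  · exact PFilter.principal_le_iff.1 hGP

theorem IsSupFilter.isPseudoprime (hM : IsDistribMeet M) {F : PFilter M} (hF : IsSupFilter F)
    (htop : F ≠ ⊤) : IsPseudoprime F := by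
  classical
  refine ⟨htop, fun A hA => ?_⟩
  by_contra! hcon
  obtain ⟨K, hK, hAK, hKF⟩ := hA.exists_compact
  obtain ⟨c, rfl⟩ := isCompactElement_filter_iff.1 hK
  have hex : ∀ G : A, ∃ a ∈ G.1, a ∉ F := fun G => Set.not_subset.1 (hcon G.1 G.2)
  choose a haG haF using hex
  have hlub := isLUB_inf_image hM (Set.finite_range a) (c := c) fun u hu =>
    hAK (mem_finset_inf_filter.2 fun G hG =>
      PFilter.mem_of_le (hu ⟨⟨G, hG⟩, rfl⟩) (haG ⟨G, hG⟩))
  obtain ⟨_, ⟨_, ⟨G, rfl⟩, rfl⟩, hmem⟩ := hF _ c ((Set.finite_range a).image _) hlub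
    (PFilter.principal_le_iff.1 hKF)
  exact haF G (PFilter.mem_of_le inf_le_right hmem)

/-! #### A model of the distributive envelope -/

/-- The sets `φ(a) = {F | a ∈ F}` of sup-filters. -/
def phi (a : M) : Set {F : PFilter M // IsSupFilter F} := {F | a ∈ F.1}

theorem phi_inf (a b : M) : phi (a ⊓ b) = phi a ∩ phi b := by
  ext F
  exact PFilter.inf_mem_iff

theorem phi_top : phi (⊤ : M) = Set.univ :=
  Set.eq_univ_of_forall fun F => top_mem_filter F.1

/-- Finite unions of the sets `φ(a)`. -/
def phiUnion (s : Finset M) : Set {F : PFilter M // IsSupFilter F} := {F | ∃ a ∈ s, a ∈ F.1}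

/-- The nonempty finite unions of the sets `φ(a)` form a distributive lattice. -/
def envelope (M : Type u) [SemilatticeInf M] [OrderTop M] :
    Sublattice (Set {F : PFilter M // IsSupFilter F}) where
  carrier := {d | ∃ s : Finset M, s.Nonempty ∧ d = phiUnion s}
  supClosed' := by
    classical
    rintro _ ⟨s, hs, rfl⟩ _ ⟨t, ht, rfl⟩
    refine ⟨s ∪ t, hs.mono Finset.subset_union_left, ?_⟩
    ext F
    simp only [phiUnion, Set.sup_eq_union, Set.mem_union, Set.mem_ofPred_eq, Finset.mem_union]
    grind
  infClosed' := by
    classical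
    rintro _ ⟨s, hs, rfl⟩ _ ⟨t, ht, rfl⟩
    refine ⟨(s ×ˢ t).image fun p => p.1 ⊓ p.2, (hs.product ht).image _, ?_⟩
    ext F
    constructor
    · rintro ⟨⟨a, ha, haF⟩, ⟨b, hb, hbF⟩⟩
      exact ⟨a ⊓ b, Finset.mem_image.2 ⟨(a, b), Finset.mem_product.2 ⟨ha, hb⟩, rfl⟩,
        PFilter.inf_mem haF hbF⟩
    · rintro ⟨c, hc, hcF⟩
      obtain ⟨⟨a, b⟩, hab, rfl⟩ := Finset.mem_image.1 hc
      rw [Finset.mem_product] at hab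
      exact ⟨⟨a, hab.1, PFilter.mem_of_le inf_le_left hcF⟩,
        ⟨b, hab.2, PFilter.mem_of_le inf_le_right hcF⟩⟩

instance : OrderTop (envelope M) where
  top := ⟨Set.univ, {⊤}, Finset.singleton_nonempty _, by
    ext F; simpa [phiUnion] using top_mem_filter F.1⟩
  le_top d := Set.subset_univ d.1

/-- The embedding `a ↦ φ(a)`. -/
def envelopeMap (a : M) : envelope M :=
  ⟨phi a, {a}, Finset.singleton_nonempty _, by ext F; simp [phi, phiUnion]⟩

theorem isSupHom_envelopeMap : IsSupHom (envelopeMap (M := M)) where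
  map_top := Subtype.ext phi_top
  map_inf a b := Subtype.ext (phi_inf a b)
  map_isLUB S c hS hc := by
    refine ⟨?_, fun d hd F hF => ?_⟩
    · rintro _ ⟨a, ha, rfl⟩ F hF
      exact PFilter.mem_of_le (hc.1 ha) hF
    · obtain ⟨a, ha, haF⟩ := F.2 S c hS hc hF
      exact hd ⟨a, ha, rfl⟩ haF

theorem le_sup'_of_phi_subset (hM : IsDistribMeet M) {E : Type u} [DistribLattice E] [OrderTop E]
    {f : M → E} (hf : IsSupHom f) {c : M} {t : Finset M} (ht : t.Nonempty)
    (h : phi c ⊆ phiUnion t) : f c ≤ t.sup' ht f := by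
  have hub : ∀ u ∈ upperBounds (t : Set M), c ≤ u := by
    intro u hu
    by_contra hcu
    obtain ⟨P, hP, hcP, huP⟩ := exists_primeFilter hM (F := PFilter.principal c) (a := u) hcu
    obtain ⟨a, ha, haP⟩ := h (show (⟨P, (IsPseudoprime.of_infPrime hP).isSupFilter⟩ :
      {F : PFilter M // IsSupFilter F}) ∈ phi c from hcP (mem_principal_filter.2 le_rfl))
    exact huP (PFilter.mem_of_le (hu ha) haP)
  have hlub := hf.map_isLUB _ c (t.finite_toSet.image _)
    (isLUB_inf_image hM t.finite_toSet hub)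
  refine hlub.2 ?_
  rintro _ ⟨_, ⟨a, ha, rfl⟩, rfl⟩
  rw [hf.map_inf]
  exact inf_le_right.trans (Finset.le_sup' f ha)

theorem isDistribEnvelope_envelopeMap (hM : IsDistribMeet M) :
    IsDistribEnvelope (envelopeMap (M := M)) where
  isSupHom := isSupHom_envelopeMap
  existsUnique_lift E _ _ f hf := by
    classical
    choose s hs hd using fun d : envelope M => d.2
    have hle : ∀ (d : envelope M) (t : Finset M) (ht : t.Nonempty), d.1 ⊆ phiUnion t →
        (s d).sup' (hs d) f ≤ t.sup' ht f := fun d t ht h =>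
      Finset.sup'_le _ _ fun c hc => le_sup'_of_phi_subset hM hf ht fun F hF =>
        h (by rw [hd d]; exact ⟨c, hc, hF⟩)
    have hge : ∀ (d : envelope M) (c : M), phi c ⊆ d.1 → f c ≤ (s d).sup' (hs d) f :=
      fun d c h => le_sup'_of_phi_subset hM hf (hs d) (by rw [← hd d]; exact h)
    have hmono : ∀ d d' : envelope M, d ≤ d' →
        (s d).sup' (hs d) f ≤ (s d').sup' (hs d') f := fun d d' h =>
      hle d _ _ (by rw [← hd d']; exact h)
    refine ⟨fun d => (s d).sup' (hs d) f, ⟨⟨?_, ?_, ?_⟩, ?_⟩, ?_⟩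
    · refine top_le_iff.1 ?_
      rw [← hf.map_top]
      exact hge _ _ (Set.subset_univ _)
    · intro d d'
      refine le_antisymm (le_inf (hmono _ _ inf_le_left) (hmono _ _ inf_le_right)) ?_
      rw [Finset.sup'_inf_distrib_right]
      refine Finset.sup'_le _ _ fun a ha => ?_
      rw [Finset.sup'_inf_distrib_left]
      refine Finset.sup'_le _ _ fun b hb => ?_
      rw [← hf.map_inf]
      refine hge _ _ ?_
      rw [phi_inf]
      rintro F ⟨haF, hbF⟩
      refine ⟨?_, ?_⟩
      · rw [hd d]; exact ⟨a, ha, haF⟩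
      · rw [hd d']; exact ⟨b, hb, hbF⟩
    · intro S c hS hc
      refine ⟨?_, fun b hb => ?_⟩
      · rintro _ ⟨d, hdS, rfl⟩
        exact hmono _ _ (hc.1 hdS)
      · rcases S.eq_empty_or_nonempty with rfl | ⟨d₀, hd₀⟩
        · refine Finset.sup'_le _ _ fun a ha => ?_
          have hbot : ∀ x : M, a ≤ x := by
            intro x
            by_contra hax
            obtain ⟨P, hP, haP, hxP⟩ :=
              exists_primeFilter hM (F := PFilter.principal a) (a := x) hax
            have hcx : c ≤ envelopeMap x := hc.2 (by simp)
            refine hxP (hcx (show (⟨P, (IsPseudoprime.of_infPrime hP).isSupFilter⟩ :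
              {F : PFilter M // IsSupFilter F}) ∈ c.1 from ?_))
            rw [hd c]
            exact ⟨a, ha, haP (mem_principal_filter.2 le_rfl)⟩
          have := hf.map_isLUB ∅ a Set.finite_empty ⟨by simp, fun x _ => hbot x⟩
          exact this.2 (by simp)
        · let t : Finset M := hS.toFinset.biUnion s
          have ht : t.Nonempty := by
            obtain ⟨a, ha⟩ := hs d₀
            exact ⟨a, Finset.mem_biUnion.2 ⟨d₀, hS.mem_toFinset.2 hd₀, ha⟩⟩
          have hct : c ≤ ⟨phiUnion t, t, ht, rfl⟩ := hc.2 fun d hdS F hF => by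
            rw [hd d] at hF
            obtain ⟨a, ha, haF⟩ := hF
            exact ⟨a, Finset.mem_biUnion.2 ⟨d, hS.mem_toFinset.2 hdS, ha⟩, haF⟩
          refine (hle c t ht hct).trans (Finset.sup'_le _ _ fun a ha => ?_)
          obtain ⟨d, hdS, had⟩ := Finset.mem_biUnion.1 ha
          exact (Finset.le_sup' f had).trans (hb ⟨d, hS.mem_toFinset.1 hdS, rfl⟩)
    · funext a
      refine le_antisymm ?_ (hge _ _ subset_rfl)
      have := hle (envelopeMap a) {a} (Finset.singleton_nonempty a)
        (fun F hF => ⟨a, Finset.mem_singleton_self a, hF⟩)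
      simpa using this
    · rintro g ⟨hg, hge'⟩
      funext d
      have h1 : IsLUB (envelopeMap '' (s d : Set M)) d := by
        refine ⟨?_, fun d' hd' F hF => ?_⟩
        · rintro _ ⟨a, ha, rfl⟩ F hF
          show F ∈ d.1
          rw [hd d]
          exact ⟨a, ha, hF⟩
        · have hF' : F ∈ d.1 := hF
          rw [hd d] at hF'
          obtain ⟨a, ha, haF⟩ := hF'
          exact hd' ⟨a, ha, rfl⟩ haF
      have h2 := hg.map_isLUB _ d ((s d).finite_toSet.image _) h1
      rw [← Set.image_comp, hge'] at h2
      refine h2.unique ⟨?_, fun b hb => Finset.sup'_le _ _ fun a ha => hb ⟨a, ha, rfl⟩⟩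
      rintro _ ⟨a, ha, rfl⟩
      exact Finset.le_sup' f ha

theorem IsOptimal.isSupFilter {F : PFilter M} (hF : IsOptimal F) : IsSupFilter F := by
  obtain ⟨D, _, _, e, he, P, hP, hFP⟩ := hF
  intro S c hS hc hcF
  obtain ⟨_, ⟨a, ha, rfl⟩, haP⟩ :=
    (IsPseudoprime.of_infPrime (isPrimeFilter_iff.1 hP)).isSupFilter _ _ (hS.image e)
      (he.isSupHom.map_isLUB S c hS hc) ((hFP c).1 hcF)
  exact ⟨a, ha, (hFP a).2 haP⟩

theorem IsSupFilter.isOptimal (hM : IsDistribMeet M) {F : PFilter M} (hF : IsSupFilter F)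
    (htop : F ≠ ⊤) : IsOptimal F := by
  refine ⟨envelope M, inferInstance, inferInstance, envelopeMap,
    isDistribEnvelope_envelopeMap hM, mkFilter {d | ⟨F, hF⟩ ∈ d.1}
      (Set.mem_univ (⟨F, hF⟩ : {F : PFilter M // IsSupFilter F}))
      (fun _ h _ h' => ⟨h, h'⟩) (fun _ _ h h' => h h'), ⟨fun h => htop ?_, fun G H hGH => ?_⟩,
    fun a => Iff.rfl⟩
  · refine top_le_iff.1 fun a _ => ?_
    have : envelopeMap a ∈ (⊤ : PFilter (envelope M)) := mem_top_filter _
    rw [← h] at this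
    exact this
  · by_contra! hcon
    obtain ⟨d, hdG, hd⟩ := Set.not_subset.1 hcon.1
    obtain ⟨d', hdH, hd'⟩ := Set.not_subset.1 hcon.2
    rcases hGH (show d ⊔ d' ∈ _ from ⟨PFilter.mem_of_le le_sup_left hdG,
      PFilter.mem_of_le le_sup_right hdH⟩) with h | h
    · exact hd h
    · exact hd' h

/-- `X_M`: the optimal filters together with the improper filter. -/
def xSet (M : Type u) [SemilatticeInf M] [OrderTop M] : Set (PFilter M) := {F | IsOptimal F} ∪ {⊤}

theorem xSet_eq_ySet (hM : IsDistribMeet M) : xSet M = ySet (PFilter M) := by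
  ext F
  by_cases htop : F = ⊤
  · exact ⟨fun _ => Or.inr htop, fun _ => Or.inr htop⟩
  · constructor
    · rintro (h | h)
      · exact Or.inl (h.isSupFilter.isPseudoprime hM htop)
      · exact Or.inr h
    · rintro (h | h)
      · exact Or.inl (h.isSupFilter.isOptimal hM htop)
      · exact Or.inr h

/-- The topology on a set of filters with the subbasis of the sets `φ(a) = {F | a ∈ F}` and their
complements. -/
@[reducible]
def filterTopology (S : Set (PFilter M)) : TopologicalSpace S :=
  TopologicalSpace.generateFrom
    ({U | ∃ a : M, U = {F : S | a ∈ F.1}} ∪ {U | ∃ b : M, U = {F : S | b ∈ F.1}ᶜ})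

instance : TopologicalSpace (xSet M) := filterTopology (xSet M)

/-- The prime filters, as a subset of `X_M`. -/
def xPrimes (M : Type u) [SemilatticeInf M] [OrderTop M] : Set (xSet M) :=
  {F | IsPrimeFilter F.1}

/-- The improper filter `M`, as a point of `X_M`. -/
def xTop (M : Type u) [SemilatticeInf M] [OrderTop M] : xSet M := ⟨⊤, Or.inr rfl⟩

theorem filterTopology_ySet :
    filterTopology (ySet (PFilter M)) = (patchTopology (PFilter M)).induced Subtype.val := by
  rw [patchTopology, induced_generateFrom_eq, filterTopology]
  congr 1
  ext U
  constructor
  · rintro (⟨a, rfl⟩ | ⟨a, rfl⟩)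
    · refine ⟨_, Or.inl ⟨PFilter.principal a, isCompactElement_principal a, rfl⟩, ?_⟩
      ext F
      exact PFilter.principal_le_iff
    · refine ⟨_, Or.inr ⟨PFilter.principal a, isCompactElement_principal a, rfl⟩, ?_⟩
      ext F
      exact not_congr PFilter.principal_le_iff
  · rintro ⟨_, ⟨K, hK, rfl⟩ | ⟨K, hK, rfl⟩, rfl⟩
    · obtain ⟨a, rfl⟩ := isCompactElement_filter_iff.1 hK
      refine Or.inl ⟨a, ?_⟩
      ext F
      exact PFilter.principal_le_iff
    · obtain ⟨a, rfl⟩ := isCompactElement_filter_iff.1 hK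
      refine Or.inr ⟨a, ?_⟩
      ext F
      exact not_congr PFilter.principal_le_iff

theorem isPGPS_filter_aux (hM : IsDistribMeet M) {S : Set (PFilter M)}
    (hS : S = ySet (PFilter M)) (htop : ⊤ ∈ S) :
    @IsPGPS S (filterTopology S) _ {F | IsPrimeFilter F.1} ⟨⊤, htop⟩ ∧
      ∀ U, @IsAdmissible S (filterTopology S) _ {F | IsPrimeFilter F.1} U ↔
        ∃ a, U = {F | a ∈ F.1} := by
  subst hS
  rw [filterTopology_ySet]
  have hprime : {F : ySet (PFilter M) | IsPrimeFilter F.1} = yPrimes (PFilter M) :=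
    Set.ext fun F => isPrimeFilter_iff
  rw [hprime]
  refine ⟨isPGPS_ySet (isFrameLattice_filter hM), fun U =>
    (isAdmissible_ySet_iff (isFrameLattice_filter hM)).trans ⟨?_, ?_⟩⟩
  · rintro ⟨K, hK, rfl⟩
    obtain ⟨a, rfl⟩ := isCompactElement_filter_iff.1 hK
    refine ⟨a, ?_⟩
    ext F
    exact PFilter.principal_le_iff
  · rintro ⟨a, rfl⟩
    refine ⟨_, isCompactElement_principal a, ?_⟩
    ext F
    exact PFilter.principal_le_iff.symm

theorem isPGPS_xSet (hM : IsDistribMeet M) : IsPGPS (xPrimes M) (xTop M) :=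
  (isPGPS_filter_aux hM (xSet_eq_ySet hM) (Or.inr rfl)).1

theorem isAdmissible_xSet_iff (hM : IsDistribMeet M) {U : Set (xSet M)} :
    IsAdmissible (xPrimes M) U ↔ ∃ a, U = {F | a ∈ F.1} :=
  (isPGPS_filter_aux hM (xSet_eq_ySet hM) (Or.inr rfl)).2 U

/-- The relation `R_α ⊆ X_N × X_M` of `α : M → N`: `x R_α y` iff `α⁻¹(x) ⊆ y`. -/
def xRel (f : InfTopHom M N) (x : xSet N) (y : xSet M) : Prop := ∀ a, f a ∈ x.1 → a ∈ y.1

theorem box_xRel (hM : IsDistribMeet M) (f : InfTopHom M N) (a : M) :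
    box (xRel f) {y : xSet M | a ∈ y.1} = {x : xSet N | f a ∈ x.1} := by
  ext x
  refine ⟨fun h => ?_, fun h y hy => hy a h⟩
  by_contra hax
  obtain ⟨P, hP, hxP, haP⟩ := exists_primeFilter hM (F := filterComap f x.1) (a := a) hax
  exact haP (h ⟨P, xSet_eq_ySet hM ▸ Or.inl (.of_infPrime hP)⟩ fun b hb => hxP hb)

theorem isGPMorphism_xRel (hM : IsDistribMeet M) (hN : IsDistribMeet N) (f : InfTopHom M N) :
    IsGPMorphism (xPrimes N) (xPrimes M) (xRel f) where
  separated x y h := by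
    unfold xRel at h
    push Not at h
    obtain ⟨a, hax, hay⟩ := h
    exact ⟨_, (isAdmissible_xSet_iff hM).2 ⟨a, rfl⟩, fun z hz => hz a hax, hay⟩
  box_admissible U hU := by
    obtain ⟨a, rfl⟩ := (isAdmissible_xSet_iff hM).1 hU
    rw [box_xRel hM]
    exact (isAdmissible_xSet_iff hN).2 ⟨f a, rfl⟩

end Optimal

/-- The contravariant functor `𝓧`: it sends `M` to `⟨X_M, τ, ⊆, Pr(M), M⟩` and `α` to `R_α`. -/
def xFunctor : DMS.{u} ⥤ PGPS.{u}ᵒᵖ where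
  obj M := .op
    { carrier := xSet M
      dom := xPrimes M
      pt := xTop M
      isPGPS := isPGPS_xSet M.distrib }
  map {M N} f := Quiver.Hom.op
    ({ rel := xRel (M := M) (N := N) f
       isGPMorphism := isGPMorphism_xRel M.distrib N.distrib f } : PGPS.Hom _ _)
  map_id M := by
    apply Quiver.Hom.unop_inj
    apply PGPS.Hom.ext
    rfl
  map_comp {M N K} f g := by
    apply Quiver.Hom.unop_inj
    apply PGPS.Hom.ext
    funext x y
    apply propext
    have hgf := (isGPMorphism_xRel M.distrib K.distrib (f ≫ g)).iff_forall x y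
    refine hgf.trans (forall₂_congr fun U hU => ?_)
    obtain ⟨a, rfl⟩ := (isAdmissible_xSet_iff M.distrib).1 hU
    rw [box_xRel M.distrib (N := K) (f ≫ g)]
    show _ ↔ (x ∈ box (xRel (M := N) (N := K) g) (box (xRel (M := M) (N := N) f)
      {y : xSet M | a ∈ y.1}) → _)
    rw [box_xRel M.distrib (N := N) f, box_xRel N.distrib (N := K) g]
    rfl

/-- The map `U ↦ U` from `𝓐(X)` to `𝓚(𝓥ᵃ(X))`: an admissible clopen upset is regarded as a compact
element of the frame of admissible closed upsets. -/
def admToCompact (X : PGPS.{u}ᵒᵖ) :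
    admFunctor.obj X ⟶ (vietorisFunctor ⋙ compactFunctor).obj X :=
  ({ toFun := fun U => ⟨AdmClosed.ofAdmissible X.unop.isPGPS U.isAdmissible,
        (AdmClosed.isCompactElement_iff X.unop.isPGPS).2 U.isAdmissible⟩
     map_inf' := fun U V => CompactElt.ext (AdmClosed.ext (by
        show U.carrier ∩ V.carrier = (AdmClosed.ofAdmissible X.unop.isPGPS U.isAdmissible ⊔
          AdmClosed.ofAdmissible X.unop.isPGPS V.isAdmissible).carrier
        ext x
        rw [← sSup_pair, AdmClosed.mem_sSup]
        simp [AdmClosed.ofAdmissible]))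
     map_top' := CompactElt.ext (AdmClosed.ext (by
        show Set.univ = (⊥ : AdmClosed X.unop.dom).carrier
        ext x
        rw [← sSup_empty, AdmClosed.mem_sSup]
        simp)) } :
    InfTopHom (AdmClopen X.unop.dom) (CompactElt (AdmClosed X.unop.dom)))

end GenPriestley

open GenPriestley

/-!
A distributive meet-semilattice `M` is recovered from its lattice of filters as the set of principal
filters, which are exactly the compact filters; conversely, an algebraic frame `L` is recovered from
its compact elements, since `a ↦ {k | k ≤ a}` identifies `L` with the filters of `𝓚(L)`.

Prime elements separate the elements of an algebraic frame `L`, so `a` is the infimum of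
`↑a ∩ Y_L`, and `a ↦ ↑a ∩ Y_L` is an isomorphism from `L` onto `𝓥ᵃ(𝓨(L))`. The functor `𝓥ᵃ` is fully
faithful: a morphism `R` is determined by `□_R`, and a map `f` that preserves joins and compact
elements is `□_R` for the relation `x R y` given by `x ∈ f(C) → y ∈ C` for all `C`. Hence the
unit alone makes `𝓨` and `𝓥ᵃ` inverse to each other.

The third equivalence is the composite of the first two: the optimal filters of `M` are the
pseudoprime elements of its lattice of filters, whence `𝓧 = 𝓨 ∘ 𝓕`, and the admissible clopen
upsets are the compact admissible closed upsets, whence `𝓐 ≅ 𝓚 ∘ 𝓥ᵃ`.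
-/

namespace GenPriestley

theorem isCompactElement_orderIso {α β : Type*} [PartialOrder α] [PartialOrder β] (e : α ≃o β)
    {k : α} (hk : IsCompactElement k) : IsCompactElement (e k) := by
  intro S b hne hdir hb hkb
  have hlub : IsLUB (e.symm '' S) (e.symm b) := e.symm.isLUB_image'.2 hb
  obtain ⟨_, ⟨x, hx, rfl⟩, hkx⟩ := hk (e.symm '' S) (e.symm b) (hne.image _)
    (hdir.mono_comp fun _ _ h => e.symm.monotone h) hlub (e.le_symm_apply.2 hkb)
  exact ⟨x, hx, e.le_symm_apply.1 hkx⟩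

/-- The isomorphism of `DMS` given by an order isomorphism. -/
def DMS.Iso.mk {M N : DMS.{u}} (e : M ≃o N) : M ≅ N where
  hom := (e : InfTopHom M N)
  inv := (e.symm : InfTopHom N M)
  hom_inv_id := DFunLike.ext (F := InfTopHom M M) _ _ e.symm_apply_apply
  inv_hom_id := DFunLike.ext (F := InfTopHom N N) _ _ e.apply_symm_apply

/-- The morphism of `AlgFrmJ` given by an order isomorphism. -/
def AlgFrmJ.Hom.ofOrderIso {L N : AlgFrmJ.{u}} (e : L ≃o N) : AlgFrmJ.Hom L N where
  toFun := e
  map_sSup S := by rw [sSup_image, e.map_sSup]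
  map_compact _ hk := isCompactElement_orderIso e hk

/-- The isomorphism of `AlgFrmJ` given by an order isomorphism. -/
def AlgFrmJ.Iso.mk {L N : AlgFrmJ.{u}} (e : L ≃o N) : L ≅ N where
  hom := AlgFrmJ.Hom.ofOrderIso e
  inv := AlgFrmJ.Hom.ofOrderIso e.symm
  hom_inv_id := AlgFrmJ.Hom.ext (funext e.symm_apply_apply)
  inv_hom_id := AlgFrmJ.Hom.ext (funext e.apply_symm_apply)

section FilterEquivalence

/-- A meet-semilattice with top is the dual of the compact elements of its lattice of filters, via
principal filters. -/
noncomputable def principalOrderIso (M : Type u) [SemilatticeInf M] [OrderTop M] :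
    M ≃o CompactElt (PFilter M) :=
  RelIso.ofSurjective
    (OrderEmbedding.ofMapLEIff (fun a => ⟨PFilter.principal a, isCompactElement_principal a⟩)
      fun _ _ => PFilter.principal_le_principal_iff)
    fun K =>
      let ⟨a, ha⟩ := isCompactElement_filter_iff.1 K.isCompact
      ⟨a, CompactElt.ext ha.symm⟩

variable {L N : Type u} [CompleteLattice L] [CompleteLattice N]

/-- The compact elements below `a`, as a filter of the dual of the compact elements. -/
def compactsBelow (a : L) : PFilter (CompactElt L) :=
  mkFilter {k | k.val ≤ a} bot_le (fun _ hk _ hl => sup_le hk hl) fun _ _ h hk => le_trans h hk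

/-- The join in `L` of a filter of the dual of the compact elements of `L`. -/
def filterJoin (F : PFilter (CompactElt L)) : L :=
  sSup (CompactElt.val '' (F : Set (CompactElt L)))

theorem val_le_filterJoin_iff {F : PFilter (CompactElt L)} {k : CompactElt L} :
    k.val ≤ filterJoin F ↔ k ∈ F := by
  refine ⟨fun h => ?_, fun h => le_sSup ⟨k, h, rfl⟩⟩
  have hdir : DirectedOn (· ≤ ·) (CompactElt.val '' (F : Set (CompactElt L))) := by
    rintro _ ⟨a, ha, rfl⟩ _ ⟨b, hb, rfl⟩
    exact ⟨_, ⟨a ⊓ b, PFilter.inf_mem ha hb, rfl⟩, le_sup_left, le_sup_right⟩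
  obtain ⟨_, ⟨l, hl, rfl⟩, hkl⟩ :=
    k.isCompact _ _ (F.nonempty.image _) hdir (isLUB_sSup _) h
  have hlk : l ≤ k := hkl
  exact PFilter.mem_of_le hlk hl

theorem compactsBelow_filterJoin (F : PFilter (CompactElt L)) : compactsBelow (filterJoin F) = F :=
  SetLike.ext fun _ => val_le_filterJoin_iff

theorem filterJoin_compactsBelow [IsCompactlyGenerated L] (a : L) :
    filterJoin (compactsBelow a) = a := by
  apply le_antisymm
  · exact sSup_le (Set.forall_mem_image.2 fun _ hk => hk)
  · rw [le_iff_compact_le_imp]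
    exact fun k hk hka => le_sSup ⟨⟨k, hk⟩, hka, rfl⟩

/-- An algebraic lattice is the lattice of filters of the dual of its compact elements. -/
def filterCompactOrderIso (L : Type u) [CompleteLattice L] [IsCompactlyGenerated L] :
    PFilter (CompactElt L) ≃o L :=
  Equiv.toOrderIso ⟨filterJoin, compactsBelow, compactsBelow_filterJoin, filterJoin_compactsBelow⟩
    (fun _ _ h => sSup_le_sSup (Set.image_mono h)) fun _ _ h _ hk => le_trans hk h

theorem filterJoin_filterMap {f : L → N} (hf : ∀ S, f (sSup S) = sSup (f '' S))
    {g : InfTopHom (CompactElt L) (CompactElt N)} (hg : ∀ k, (g k).val = f k.val)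
    (F : PFilter (CompactElt L)) : filterJoin (filterMap g F) = f (filterJoin F) := by
  rw [filterJoin, filterJoin, hf]
  apply le_antisymm <;> apply sSup_le
  · rintro _ ⟨l, ⟨k, hk, hkl⟩, rfl⟩
    calc l.val ≤ (g k).val := hkl
      _ = f k.val := hg k
      _ ≤ _ := le_sSup (Set.mem_image_of_mem f (Set.mem_image_of_mem CompactElt.val hk))
  · rintro _ ⟨_, ⟨k, hk, rfl⟩, rfl⟩
    exact le_sSup ⟨g k, ⟨k, hk, le_rfl⟩, hg k⟩

/-- The natural isomorphism `M ≅ 𝓚(𝓕(M))`. -/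
noncomputable def filterUnit : 𝟭 DMS.{u} ≅ filterFunctor ⋙ compactFunctor :=
  NatIso.ofComponents
    (fun M => DMS.Iso.mk (N := (filterFunctor ⋙ compactFunctor).obj M) (principalOrderIso M))
    fun {M N} f => DFunLike.ext (F := InfTopHom M (CompactElt (PFilter N))) _ _ fun a =>
      CompactElt.ext (filterMap_principal (M := M) (N := N) f a).symm

/-- The natural isomorphism `𝓕(𝓚(L)) ≅ L`. -/
def filterCounit : compactFunctor ⋙ filterFunctor ≅ 𝟭 AlgFrmJ.{u} :=
  NatIso.ofComponents
    (fun L => AlgFrmJ.Iso.mk (L := (compactFunctor ⋙ filterFunctor).obj L)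
      (filterCompactOrderIso L))
    fun f => AlgFrmJ.Hom.ext (funext (filterJoin_filterMap f.map_sSup fun _ => rfl))

/-- The equivalence of `DMS` and `AlgFrmJ` given by `𝓕` and `𝓚`. -/
noncomputable def filterEquivalence : DMS.{u} ≌ AlgFrmJ.{u} :=
  .mk filterFunctor compactFunctor filterUnit filterCounit

end FilterEquivalence

section UpClosed

variable {L : Type u} [CompleteLattice L] [IsCompactlyGenerated L]

theorem isClosed_up (a : L) : IsClosed {y : ySet L | a ≤ y.1} := by
  have hinter : {y : ySet L | a ≤ y.1} =
      ⋂ k ∈ {k : L | IsCompactElement k ∧ k ≤ a}, {y : ySet L | k ≤ y.1} := by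
    ext y
    simp only [Set.mem_iInter, Set.mem_ofPred_eq, and_imp]
    exact le_iff_compact_le_imp
  rw [hinter]
  exact isClosed_biInter fun k hk => (isClopen_up hk.1).isClosed

theorem exists_mem_yPrimes (hL : IsFrameLattice L) {a b : L} (hab : ¬ a ≤ b) :
    ∃ p ∈ yPrimes L, b ≤ p.1 ∧ ¬ a ≤ p.1 :=
  let ⟨p, hp, hbp, hap⟩ := exists_infPrime hL hab
  ⟨⟨p, Or.inl (.of_infPrime hp)⟩, hp, hbp, hap⟩

/-- The admissible closed upset `↑a ∩ Y_L`. -/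
def upClosed (hL : IsFrameLattice L) (a : L) : AdmClosed (yPrimes L) where
  carrier := {y | a ≤ y.1}
  isClosed := isClosed_up a
  isUpperSet := isUpperSet_up a
  compl_eq := compl_eq_lowerClosure (isUpperSet_up a) fun _ hx =>
    let ⟨p, hp, hxp, hap⟩ := exists_mem_yPrimes hL hx
    ⟨p, hp, hap, hxp⟩

theorem sInf_upClosed (hL : IsFrameLattice L) (a : L) :
    sInf (Subtype.val '' (upClosed hL a).carrier) = a := by
  apply le_antisymm
  · by_contra h
    obtain ⟨p, -, hap, hp⟩ := exists_mem_yPrimes hL h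
    exact hp (sInf_le ⟨p, hap, rfl⟩)
  · exact le_sInf (Set.forall_mem_image.2 fun _ hy => hy)

theorem upClosed_sInf (hL : IsFrameLattice L) (C : AdmClosed (yPrimes L)) :
    upClosed hL (sInf (Subtype.val '' C.carrier)) = C := by
  refine AdmClosed.ext (Set.Subset.antisymm (fun y hy => ?_) fun y hy => sInf_le ⟨y, hy, rfl⟩)
  by_contra hyC
  obtain ⟨U, hU, hCU, hyU⟩ := C.exists_admissible (isPGPS_ySet hL) hyC
  obtain ⟨k, -, rfl⟩ := (isAdmissible_ySet_iff hL).1 hU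
  have hk : k ≤ sInf (Subtype.val '' C.carrier) := le_sInf (Set.forall_mem_image.2 hCU)
  exact hyU (hk.trans hy)

/-- An algebraic frame `L` is the frame of admissible closed upsets of `Y_L`. -/
def upClosedOrderIso (hL : IsFrameLattice L) : L ≃o AdmClosed (yPrimes L) :=
  Equiv.toOrderIso
    ⟨upClosed hL, fun C => sInf (Subtype.val '' C.carrier), sInf_upClosed hL, upClosed_sInf hL⟩
    (fun _ _ hab _ hy => le_trans hab hy) fun _ _ h => sInf_le_sInf (Set.image_mono h)

end UpClosed

section BoxDuality

variable {X Y : Type u} [TopologicalSpace X] [PartialOrder X] [TopologicalSpace Y] [PartialOrder Y]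
  {X₀ : Set X} {Y₀ : Set Y}

theorem IsGPMorphism.eq_of_box_eq {R S : X → Y → Prop} (hR : IsGPMorphism X₀ Y₀ R)
    (hS : IsGPMorphism X₀ Y₀ S) (h : ∀ U, IsAdmissible Y₀ U → box R U = box S U) : R = S := by
  ext x y
  rw [hR.iff_forall, hS.iff_forall]
  exact forall₂_congr fun U hU => by rw [h U hU]

/-- The largest relation `R` with `f C ⊆ □_R C` for all admissible closed upsets `C`. -/
def relOfMap (f : AdmClosed Y₀ → AdmClosed X₀) (x : X) (y : Y) : Prop :=
  ∀ C : AdmClosed Y₀, x ∈ (f C).carrier → y ∈ C.carrier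

theorem box_relOfMap {f : AdmClosed Y₀ → AdmClosed X₀} (hf : ∀ S, f (sSup S) = sSup (f '' S))
    (C : AdmClosed Y₀) : box (relOfMap f) C.carrier = (f C).carrier := by
  refine Set.Subset.antisymm (fun x hx => ?_) fun x hx y hy => hy C hx
  -- `D` is the set of all `y` with `relOfMap f x y`, as joins of closed upsets are intersections.
  set D : AdmClosed Y₀ := sSup {D | x ∈ (f D).carrier}
  have hCD : C ≤ D := fun y hy => hx y (AdmClosed.mem_sSup.1 hy)
  have hxD : x ∈ (f D).carrier := by
    rw [hf, AdmClosed.mem_sSup]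
    exact Set.forall_mem_image.2 fun _ hE => hE
  exact (gc_rightAdj hf).monotone_l hCD hxD

theorem isGPMorphism_relOfMap {m : X} {n : Y} (hX : IsPGPS X₀ m) (hY : IsPGPS Y₀ n)
    {f : AdmClosed Y₀ → AdmClosed X₀} (hf : ∀ S, f (sSup S) = sSup (f '' S))
    (hf' : ∀ C, IsCompactElement C → IsCompactElement (f C)) :
    IsGPMorphism X₀ Y₀ (relOfMap f) where
  separated x y h := by
    obtain ⟨C, hxC, hyC⟩ : ∃ C : AdmClosed Y₀, x ∈ (f C).carrier ∧ y ∉ C.carrier := by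
      simpa only [relOfMap, not_forall, exists_prop] using h
    obtain ⟨U, hU, hCU, hyU⟩ := C.exists_admissible hY hyC
    exact ⟨U, hU, fun z hz => hCU (hz C hxC), hyU⟩
  box_admissible U hU := by
    have hbox : box (relOfMap f) U = (f (AdmClosed.ofAdmissible hY hU)).carrier :=
      box_relOfMap hf (AdmClosed.ofAdmissible hY hU)
    rw [hbox, ← AdmClosed.isCompactElement_iff hX]
    exact hf' _ ((AdmClosed.isCompactElement_iff hY).2 hU)

instance : vietorisFunctor.{u}.Faithful where
  map_injective {Y _ R S} h := Quiver.Hom.unop_inj <| PGPS.Hom.ext <|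
    R.unop.isGPMorphism.eq_of_box_eq S.unop.isGPMorphism fun _ hU =>
      congrArg AdmClosed.carrier <| congrFun (congrArg AlgFrmJ.Hom.toFun h)
        (AdmClosed.ofAdmissible Y.unop.isPGPS hU)

instance : vietorisFunctor.{u}.Full where
  map_surjective {Y X} f :=
    let R : PGPS.Hom X.unop Y.unop :=
      { rel := relOfMap f.toFun
        isGPMorphism := isGPMorphism_relOfMap X.unop.isPGPS Y.unop.isPGPS f.map_sSup f.map_compact }
    ⟨Quiver.Hom.op R, AlgFrmJ.Hom.ext (funext fun C => AdmClosed.ext (box_relOfMap f.map_sSup C))⟩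

end BoxDuality

/-- The natural isomorphism `L ≅ 𝓥ᵃ(𝓨(L))`. -/
def yUnit : 𝟭 AlgFrmJ.{u} ≅ yFunctor ⋙ vietorisFunctor :=
  NatIso.ofComponents
    (fun L => AlgFrmJ.Iso.mk (N := (yFunctor ⋙ vietorisFunctor).obj L) (upClosedOrderIso L.frame))
    fun {L _} f => AlgFrmJ.Hom.ext (funext fun a =>
      AdmClosed.ext (box_yRel L.frame f.map_sSup a).symm)

/-- The natural isomorphism `𝓨(𝓥ᵃ(X)) ≅ X`, obtained from `yUnit` at `𝓥ᵃ(X)` because `𝓥ᵃ` is fully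
faithful. -/
noncomputable def yCounit : vietorisFunctor ⋙ yFunctor ≅ 𝟭 PGPS.{u}ᵒᵖ :=
  Functor.fullyFaithfulCancelRight vietorisFunctor
    (Functor.isoWhiskerLeft vietorisFunctor yUnit.symm)

/-- The dual equivalence of `AlgFrmJ` and `PGPS` given by `𝓨` and `𝓥ᵃ`. -/
noncomputable def yEquivalence : AlgFrmJ.{u} ≌ PGPS.{u}ᵒᵖ :=
  .mk yFunctor vietorisFunctor yUnit yCounit

/-- The admissible clopen upsets are the compact admissible closed upsets. -/
def admClopenOrderIso {X : Type u} [TopologicalSpace X] [PartialOrder X] {X₀ : Set X} {m : X}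
    (h : IsPGPS X₀ m) : AdmClopen X₀ ≃o CompactElt (AdmClosed X₀) where
  toFun U := ⟨AdmClosed.ofAdmissible h U.isAdmissible,
    (AdmClosed.isCompactElement_iff h).2 U.isAdmissible⟩
  invFun K := ⟨K.val.carrier, (AdmClosed.isCompactElement_iff h).1 K.isCompact⟩
  left_inv _ := rfl
  right_inv _ := rfl
  map_rel_iff' := Iff.rfl

/-- The natural isomorphism `𝓐(X) ≅ 𝓚(𝓥ᵃ(X))`, `U ↦ U`. -/
def admIso : admFunctor.{u} ≅ vietorisFunctor ⋙ compactFunctor :=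
  NatIso.ofComponents
    (fun X => DMS.Iso.mk (N := (vietorisFunctor ⋙ compactFunctor).obj X)
      (admClopenOrderIso X.unop.isPGPS))
    fun _ => rfl

theorem admIso_hom_app (X : PGPS.{u}ᵒᵖ) : admIso.hom.app X = admToCompact X := rfl

theorem rel_subtype_heq {α β : Type*} {S S' : Set α} {T T' : Set β} (hS : S = S') (hT : T = T')
    (r : α → β → Prop) :
    (fun (x : S) (y : T) => r x.1 y.1) ≍ (fun (x : S') (y : T') => r x.1 y.1) := by
  subst hS hT
  rfl

theorem PGPS.mk_subtype_congr {α : Type u} [PartialOrder α] {S S' : Set α} (hS : S = S')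
    {t : TopologicalSpace S} {t' : TopologicalSpace S'} (ht : t ≍ t') {D : Set S} {D' : Set S'}
    (hD : Subtype.val '' D = Subtype.val '' D') {m : S} {m' : S'} (hm : m.1 = m'.1)
    (h : IsPGPS D m) (h' : IsPGPS D' m') :
    (⟨S, D, m, h⟩ : PGPS.{u}) = ⟨S', D', m', h'⟩ := by
  subst hS
  obtain rfl := eq_of_heq ht
  obtain rfl := Subtype.val_injective.image_injective hD
  obtain rfl := Subtype.val_injective hm
  rfl

theorem PGPS.Hom.op_heq {X X' Y Y' : PGPS.{u}} (hX : X = X') (hY : Y = Y') {R : X ⟶ Y}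
    {R' : X' ⟶ Y'} (h : R.rel ≍ R'.rel) : R.op ≍ R'.op := by
  subst hX hY
  obtain rfl := PGPS.Hom.ext (eq_of_heq h)
  rfl

theorem rightAdj_eq_of_gc {L N : Type u} [CompleteLattice L] [CompleteLattice N] {f : L → N}
    {g : N → L} (h : GaloisConnection f g) : rightAdj f = g :=
  funext fun _ => h.isGreatest_u.isLUB.sSup_eq

theorem image_val_xPrimes_eq {M : Type u} [SemilatticeInf M] [OrderTop M] (hM : IsDistribMeet M) :
    (Subtype.val '' xPrimes M : Set (PFilter M)) = Subtype.val '' yPrimes (PFilter M) := by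
  ext F
  simp [xPrimes, yPrimes, isPrimeFilter_iff, xSet_eq_ySet hM]

theorem unop_xFunctor_obj_eq (M : DMS.{u}) :
    (xFunctor.obj M).unop = ((filterFunctor ⋙ yFunctor).obj M).unop :=
  have hS := xSet_eq_ySet M.distrib
  PGPS.mk_subtype_congr hS
    ((congr_arg_heq filterTopology hS).trans (heq_of_eq filterTopology_ySet))
    (image_val_xPrimes_eq M.distrib) rfl
    (isPGPS_xSet M.distrib) (isPGPS_ySet (isFrameLattice_filter M.distrib))

theorem xRel_heq_yRel {M N : Type u} [SemilatticeInf M] [OrderTop M] [SemilatticeInf N] [OrderTop N]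
    (hM : IsDistribMeet M) (hN : IsDistribMeet N) (f : InfTopHom M N) :
    xRel f ≍ yRel (filterMap f) := by
  unfold yRel
  rw [rightAdj_eq_of_gc (filter_gc f)]
  exact rel_subtype_heq (xSet_eq_ySet hN) (xSet_eq_ySet hM) fun G F => filterComap f G ≤ F

theorem xFunctor_eq : xFunctor.{u} = filterFunctor ⋙ yFunctor :=
  Functor.hext (fun M => congrArg Opposite.op (unop_xFunctor_obj_eq M)) fun M N f =>
    PGPS.Hom.op_heq (unop_xFunctor_obj_eq N) (unop_xFunctor_obj_eq M)
      (xRel_heq_yRel (M := M) (N := N) M.distrib N.distrib f)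

/-- The dual equivalence of `DMS` and `PGPS` given by `𝓧` and `𝓐`, as the composite of the other
two. -/
noncomputable def xEquivalence : DMS.{u} ≌ PGPS.{u}ᵒᵖ :=
  ((filterEquivalence.trans yEquivalence).changeFunctor (eqToIso xFunctor_eq.symm)).changeInverse
    admIso.symm

end GenPriestley

/-- The functors `𝓕`, `𝓚` form an equivalence of `DMS` and `AlgFrmJ`, the functors `𝓨`, `𝓥ᵃ` a dual
equivalence of `AlgFrmJ` and `PGPS`, and the functors `𝓧`, `𝓐` a dual equivalence of `DMS` and
`PGPS`; moreover `𝓧 = 𝓨 ∘ 𝓕`, and `𝓐 = 𝓚 ∘ 𝓥ᵃ` through the natural isomorphism that sends every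
admissible clopen upset to itself. -/
theorem mainTheorem2 :
    (∃ e : DMS.{u} ≌ AlgFrmJ.{u}, e.functor = filterFunctor ∧ e.inverse = compactFunctor) ∧
    (∃ e : AlgFrmJ.{u} ≌ PGPS.{u}ᵒᵖ, e.functor = yFunctor ∧ e.inverse = vietorisFunctor) ∧
    (∃ e : DMS.{u} ≌ PGPS.{u}ᵒᵖ, e.functor = xFunctor ∧ e.inverse = admFunctor) ∧
    xFunctor.{u} = filterFunctor ⋙ yFunctor ∧
    (∃ i : admFunctor.{u} ≅ vietorisFunctor ⋙ compactFunctor,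
      ∀ X : PGPS.{u}ᵒᵖ, i.hom.app X = admToCompact X) := by
  exact ⟨⟨filterEquivalence, rfl, rfl⟩, ⟨yEquivalence, rfl, rfl⟩, ⟨xEquivalence, rfl, rfl⟩,
    xFunctor_eq, admIso, admIso_hom_app⟩
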